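/- Let $G$ be a Lie group of dimension $n+1$ that is special, i.e. $G$ is not abelian and $[x,y]$ is a linear combination of $x$ and $y$ for all $x,y$ in its Lie algebra $\mathfrak g$. Let $g$ be a left invariant Riemannian metric on $G$. Let $\mathfrak u\subset\mathfrak g$ be a commutative ideal of codimension $1$, let $b\in\mathfrak g$ be orthogonal to $\mathfrak u$ with $[b,x]=x$ for all $x\in\mathfrak u$, and suppose that $\{u_1,\dots,u_n,b\}$ is an orthonormal basis of $\mathfrak g$ with respect to $g$. Put $\lambda=g(b,b)$ (so $\lambda=1$, as $b$ belongs to an orthonormal basis). For $x\in\mathfrak g$ let $x^c$ and $x^v$ be the complete and the vertical lift to $TG$ of the left invariant vector field of $x$, and let $\widetilde g$ be the Riemannian metric on $TG$ determined by $\widetilde g(x^c,y^c)=\widetilde g(x^v,y^v)=g(x,y)$ and $\widetilde g(x^c,y^v)=0$ for $x,y\in\mathfrak g$. Let $\widetilde\nabla$ be the Levi-Civita connection of $\widetilde g$, let $\widetilde R(X,Y)Z=\widetilde\nabla_X\widetilde\nabla_YZ-\widetilde\nabla_Y\widetilde\nabla_XZ-\widetilde\nabla_{[X,Y]}Z$,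 and let the Ricci tensor be $\widetilde{Ric}(X,Y)=\sum_i\widetilde g(\widetilde R(e_i,X)Y,e_i)$ for a $\widetilde g$-orthonormal basis $(e_i)$ of the tangent space, i.e. the trace of $Z\mapsto\widetilde R(Z,X)Y$. Then for all $x,y\in\mathfrak u$, at every point of $TG$, $$\widetilde{Ric}(x^c,y^c)=-\Bigl(\frac74+\frac{2n}{\lambda}\Bigr)g(x,y)+\frac{5}{4\lambda}\sum_{i=1}^n g(x,u_i)g(u_i,y),$$ $$\widetilde{Ric}(x^v,y^v)=-\Bigl(\frac34+\frac{2n}{\lambda}\Bigr)g(x,y)+\frac{5}{4\lambda}\sum_{i=1}^n g(x,u_i)g(u_i,y),$$ $$\widetilde{Ric}(x^c,b^c)=\widetilde{Ric}(x^c,b^v)=\widetilde{Ric}(x^v,b^v)=\widetilde{Ric}(x^v,b^c)=\widetilde{Ric}(x^c,y^v)=0.$$ -/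

import Mathlib

open scoped Manifold ContDiff Bundle

noncomputable section

section RiemannianGeometry

variable {E : Type*} [NormedAddCommGroup E] [NormedSpace ℝ E] {H : Type*} [TopologicalSpace H]
  {I : ModelWithCorners ℝ E H} {M : Type*} [TopologicalSpace M] [ChartedSpace H M]

/-- A vector field on `M` is differentiable at `p` (as a section of the tangent bundle). -/
def FieldDifferentiableAt [IsManifold I 1 M] (X : ∀ q : M, TangentSpace I q) (p : M) : Prop :=
  MDifferentiableAt I I.tangent (fun q => (⟨q, X q⟩ : TangentBundle I M)) p

/-- `nabla` is the Levi-Civita connection of the metric `h` on `M`: it is torsion free and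
metric, `Z h(X, Y) = h(∇_Z X, Y) + h(X, ∇_Z Y)`. Here `nabla X p v` is `(∇_v X)(p)`. -/
structure IsLeviCivita [FiniteDimensional ℝ E] [IsManifold I 2 M]
    (h : ∀ p : M, TangentSpace I p → TangentSpace I p → ℝ)
    (nabla : CovariantDerivative I E (TangentSpace I : M → Type _)) : Prop where
  torsion_free : nabla.torsion = 0
  metric : ∀ (p : M) (v : TangentSpace I p) (X Y : ∀ q : M, TangentSpace I q),
    FieldDifferentiableAt X p → FieldDifferentiableAt Y p →
      mvfderiv I (fun q => h q (X q) (Y q)) p v =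
        h p (nabla X p v) (Y p) + h p (X p) (nabla Y p v)

variable [IsManifold I 1 M]

/-- The curvature `R(X, Y)Z = ∇_X ∇_Y Z - ∇_Y ∇_X Z - ∇_{[X, Y]} Z` of a connection. -/
def curvature (nabla : CovariantDerivative I E (TangentSpace I : M → Type _))
    (X Y Z : ∀ q : M, TangentSpace I q) (p : M) : TangentSpace I p :=
  nabla (fun q => nabla Z q (Y q)) p (X p) - nabla (fun q => nabla Z q (X q)) p (Y p)
    - nabla Z p (VectorField.mlieBracket I X Y p)

/-- The Ricci tensor `Ric(X, Y)(p)`, the trace of the endomorphism `w ↦ R(w, X)Y` of the tangent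
space at `p`; for the Levi-Civita connection of a metric `h` this is the sum of
`h(R(e_i, X)Y, e_i)` over an orthonormal basis. The trace is written in a basis of the tangent
space, the vectors of which are extended to differentiable vector fields near `p` (the value at
`p` does not depend on the extension). -/
def ricci [FiniteDimensional ℝ E]
    (nabla : CovariantDerivative I E (TangentSpace I : M → Type _))
    (X Y : ∀ q : M, TangentSpace I q) (p : M) : ℝ :=
  let e : Module.Basis (Fin (Module.finrank ℝ E)) ℝ (TangentSpace I p) := Module.finBasis ℝ E
  ∑ i, e.repr (curvature nabla (FiberBundle.extend E (e i)) X Y p) i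

/-- The vertical lift `X^v` of a vector field `X`, the infinitesimal generator of the flow
`v ↦ v + t X(x)`, `v` tangent at `x`, on the tangent bundle. -/
def verticalLift (X : ∀ q : M, TangentSpace I q) (p : TangentBundle I M) :
    TangentSpace I.tangent p :=
  mfderiv 𝓘(ℝ, ℝ) I.tangent
    (fun t : ℝ => (⟨p.1, p.2 + t • X p.1⟩ : TangentBundle I M)) 0 (1 : ℝ)

/-- The complete lift `X^c` of a vector field `X`, i.e. `κ ∘ TX` where `TX : TM → TTM` is the
tangent map of `X : M → TM` and `κ` is the canonical flip of `TTM`. In the chart `(x, v)` of `TM`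
induced by a chart of `M`, the vector `TX(x, v)` at `(x, X(x))` has components `(v, DX(x) v)`, and
`X^c(x, v) = (X(x), DX(x) v)`. Mathlib expresses vectors tangent to `TM` at `(x, v)` and at
`(x, X(x))` in the same induced chart. -/
def completeLift (X : ∀ q : M, TangentSpace I q) (p : TangentBundle I M) :
    TangentSpace I.tangent p :=
  let TX : E × E := mfderiv I I.tangent (fun q => (⟨q, X q⟩ : TangentBundle I M)) p.1 p.2
  ((X p.1, TX.2) : E × E)

end RiemannianGeometry

section LieGroups

variable {E : Type*} [NormedAddCommGroup E] [NormedSpace ℝ E] {H : Type*} [TopologicalSpace H]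
  {I : ModelWithCorners ℝ E H} {G : Type*} [TopologicalSpace G] [ChartedSpace H G] [Group G]

/-- A special Lie group: it is not abelian, and `[x, y]` is a linear combination of `x` and `y`
for all `x`, `y` in the Lie algebra. -/
structure IsSpecialLieGroup (I : ModelWithCorners ℝ E H) (G : Type*) [TopologicalSpace G]
    [ChartedSpace H G] [Group G] : Prop where
  nonabelian : ∃ a b : G, a * b ≠ b * a
  bracket : ∀ x y : GroupLieAlgebra I G, ∃ r s : ℝ, ⁅x, y⁆ = r • x + s • y

variable [IsManifold I 1 G]

/-- The Riemannian metric `g` on the Lie group `G` is left invariant. -/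
def IsLeftInvariant
    (g : Bundle.ContMDiffRiemannianMetric I ∞ E (TangentSpace I : G → Type _)) : Prop :=
  ∀ (a q : G) (v w : TangentSpace I q),
    g.inner (a * q) (mfderiv I I (fun z => a * z) q v) (mfderiv I I (fun z => a * z) q w) =
      g.inner q v w

/-- `u` is a commutative ideal of codimension one of the Lie algebra, and `b` is orthogonal to `u`
with `[b, x] = x` for all `x` in `u`. -/
structure IsAdaptedPair
    (g : Bundle.ContMDiffRiemannianMetric I ∞ E (TangentSpace I : G → Type _))
    (u : Submodule ℝ (GroupLieAlgebra I G)) (b : GroupLieAlgebra I G) : Prop where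
  ideal : ∀ y : GroupLieAlgebra I G, ∀ x ∈ u, ⁅y, x⁆ ∈ u
  commutative : ∀ x ∈ u, ∀ y ∈ u, ⁅x, y⁆ = 0
  codim_one : Module.finrank ℝ (GroupLieAlgebra I G ⧸ u) = 1
  orthogonal : ∀ x ∈ u, g.inner 1 b x = 0
  bracket : ∀ x ∈ u, ⁅b, x⁆ = x

/-- The family `e` is a basis of the Lie algebra, orthonormal for the inner product that `g`
induces on it. -/
def IsOrthonormalBasis {ι : Type*} [DecidableEq ι]
    (g : Bundle.ContMDiffRiemannianMetric I ∞ E (TangentSpace I : G → Type _))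
    (e : ι → GroupLieAlgebra I G) : Prop :=
  (∀ i j, g.inner 1 (e i) (e j) = if i = j then 1 else 0) ∧ Submodule.span ℝ (Set.range e) = ⊤

/-- The complete lift `x^c` of the left invariant vector field of `x`. -/
def lieC (x : GroupLieAlgebra I G) (p : TangentBundle I G) : TangentSpace I.tangent p :=
  completeLift (mulInvariantVectorField x) p

/-- The vertical lift `x^v` of the left invariant vector field of `x`. -/
def lieV (x : GroupLieAlgebra I G) (p : TangentBundle I G) : TangentSpace I.tangent p :=
  verticalLift (mulInvariantVectorField x) p

/-- The two components `(x, y)` of the tangent vector `xi = x^c(p) + y^v(p)` of `TG` (at every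
point the lifts of left invariant fields give each tangent vector exactly once in this form). -/
def liftComponents (p : TangentBundle I G) (xi : TangentSpace I.tangent p) :
    GroupLieAlgebra I G × GroupLieAlgebra I G :=
  Function.invFun
    (fun z : GroupLieAlgebra I G × GroupLieAlgebra I G => lieC z.1 p + lieV z.2 p) xi

/-- The Riemannian metric on `TG` induced by the left invariant metric `g` on `G`, determined by
`g̃(x^c, y^c) = g̃(x^v, y^v) = g(x, y)` and `g̃(x^c, y^v) = 0` for `x`, `y` in the Lie algebra. -/
def liftedMetric (g : Bundle.ContMDiffRiemannianMetric I ∞ E (TangentSpace I : G → Type _))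
    (p : TangentBundle I G) (xi eta : TangentSpace I.tangent p) : ℝ :=
  g.inner 1 (liftComponents p xi).1 (liftComponents p eta).1 +
    g.inner 1 (liftComponents p xi).2 (liftComponents p eta).2

end LieGroups

/-- In the induced chart the vertical lift has components `(0, X(x))`. -/
theorem verticalLift_eq {E : Type*} [NormedAddCommGroup E] [NormedSpace ℝ E] {H : Type*} [TopologicalSpace H]
  {I : ModelWithCorners ℝ E H} {M : Type*} [TopologicalSpace M] [ChartedSpace H M]
  [IsManifold I 2 M] (X : ∀ q : M, TangentSpace I q) (p : TangentBundle I M) :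
  verticalLift X p = ((0, X p.1) : E × E) := by
  have hm : IsManifold I (1+1) M := ‹_›
  have key : HasMFDerivAt 𝓘(ℝ, ℝ) I.tangent
    (fun t : ℝ => (⟨p.1, p.2 + t • X p.1⟩ : TangentBundle I M)) 0
      (ContinuousLinearMap.toSpanSingleton ℝ ((0, X p.1) : E × E)) := by
    refine ⟨?_, ?_⟩
    · have : ContMDiff 𝓘(ℝ, ℝ) I.tangent 1 (fun t : ℝ => (⟨p.1, p.2 + t • X p.1⟩ : TangentBundle I M)) := by
        intro t
        rw [Bundle.contMDiffAt_totalSpace]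
        refine ⟨contMDiffAt_const, ?_⟩
        have : (fun t : ℝ => (trivializationAt E (TangentSpace I) p.1 (⟨p.1, p.2 + t • X p.1⟩ : TangentBundle I M)).2) = fun t : ℝ => (p.2 + t • X p.1 : E) := by
          funext t
          exact (tangentBundleCore I M).coordChange_self (achart H p.1) p.1 (mem_chart_source H p.1) _
        show ContMDiffAt _ _ _ (fun t : ℝ => (trivializationAt E (TangentSpace I) p.1 (⟨p.1, p.2 + t • X p.1⟩ : TangentBundle I M)).2) t
        rw [this]
        apply ContDiffAt.contMDiffAt
        exact (contDiffAt_const (F := E)).add (contDiffAt_id.smul (contDiffAt_const (F := E)))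
      exact (this 0).continuousAt
    · have : (writtenInExtChartAt 𝓘(ℝ, ℝ) I.tangent 0 (fun t : ℝ => (⟨p.1, p.2 + t • X p.1⟩ : TangentBundle I M))) = fun t : ℝ => ((extChartAt I p.1 p.1, p.2 + t • X p.1) : E × E) := by
        funext t
        refine Prod.ext rfl ?_
        exact (tangentBundleCore I M).coordChange_self (achart H p.1) p.1 (mem_chart_source H p.1) _
      rw [this]
      apply HasFDerivAt.hasFDerivWithinAt
      have h1 : HasDerivAt (fun t : ℝ => ((extChartAt I p.1 p.1, p.2 + t • X p.1) : E × E)) ((0, X p.1) : E × E) 0 := by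
        refine (hasDerivAt_const _ _).prodMk ?_
        have h3 : ∀ a c : E, HasDerivAt (fun t : ℝ => c + t • a) a 0 := fun a c => by
          simpa using ((hasDerivAt_id (0:ℝ)).smul_const a).const_add c
        exact h3 _ _
      exact h1.hasFDerivAt
  unfold verticalLift
  rw [key.mfderiv]
  exact one_smul ℝ ((0, X p.1) : E × E)

/-- The components of a sum of lifts are the two given vectors. -/
theorem liftComponents_lift {E : Type*} [NormedAddCommGroup E] [NormedSpace ℝ E] 
    {G : Type*} [TopologicalSpace G] [ChartedSpace E G] [Group G]
    [LieGroup 𝓘(ℝ, E) ∞ G] (p : TangentBundle 𝓘(ℝ,E) G)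
    (x y : GroupLieAlgebra 𝓘(ℝ, E) G) :
    liftComponents p (lieC x p + lieV y p) = (x,y) := by
  have hinj : ∀ a b : GroupLieAlgebra 𝓘(ℝ, E) G, mulInvariantVectorField a p.1 = mulInvariantVectorField b p.1 → a = b := by
    intro a b hab
    have M : MDifferentiableAt 𝓘(ℝ, E) 𝓘(ℝ, E) (fun z : G => p.1⁻¹ * z) (p.1 * 1) :=
      (contMDiff_mul_left (I := 𝓘(ℝ, E)) (n := ∞)).contMDiffAt.mdifferentiableAt (by simp)
    have N : MDifferentiableAt 𝓘(ℝ, E) 𝓘(ℝ, E) (fun z : G => p.1 * z) 1 :=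
      (contMDiff_mul_left (I := 𝓘(ℝ, E)) (n := ∞)).contMDiffAt.mdifferentiableAt (by simp)
    have := mfderiv_comp (1:G) M N
    have h2 : ((fun z : G => p.1⁻¹ * z) ∘ fun z => p.1 * z) = id := by ext; simp
    rw [h2, mfderiv_id] at this
    have ea : ∀ a : GroupLieAlgebra 𝓘(ℝ, E) G, a = mfderiv 𝓘(ℝ, E) 𝓘(ℝ, E) (fun z : G => p.1⁻¹ * z) (p.1 * 1) (mulInvariantVectorField a p.1) := by
      intro a
      exact congrArg (fun L => L a) this
    rw [ea a, ea b, hab]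
  apply Function.leftInverse_invFun (f := fun z : GroupLieAlgebra 𝓘(ℝ, E) G × GroupLieAlgebra 𝓘(ℝ, E) G => lieC z.1 p + lieV z.2 p) _ (x,y)
  rintro ⟨a, b⟩ ⟨c, d⟩ h
  simp only [lieV, verticalLift_eq] at h
  have h1 : (mulInvariantVectorField a p.1 : E) + 0 = mulInvariantVectorField c p.1 + 0 := congrArg (Prod.fst : E × E → E) h
  have hac := hinj a c (by simpa using! h1)
  subst hac
  have h2 := congrArg (Prod.snd : E × E → E) h
  have h4 : ∀ r s t : E, r + s = r + t → s = t := fun _ _ _ => add_left_cancel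
  rw [hinj b d (h4 _ _ _ h2)]

/-- The defining relations of the lifted metric, in one formula. -/
theorem liftedMetric_lift {E : Type*} [NormedAddCommGroup E] [NormedSpace ℝ E]
    {G : Type*} [TopologicalSpace G] [ChartedSpace E G] [Group G] [LieGroup 𝓘(ℝ, E) ∞ G]
    (g : Bundle.ContMDiffRiemannianMetric 𝓘(ℝ, E) ∞ E (TangentSpace 𝓘(ℝ, E) : G → Type _))
    (p : TangentBundle 𝓘(ℝ, E) G) (x y z w : GroupLieAlgebra 𝓘(ℝ, E) G) :
    liftedMetric g p (lieC x p + lieV y p) (lieC z p + lieV w p) =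
      g.inner 1 x z + g.inner 1 y w := by
  simp only [liftedMetric, liftComponents_lift]

end

/-!
The complete and vertical lifts of left invariant fields form a global frame of `TG`, and in this
frame every object of the theorem has constant coefficients; the Ricci tensor is then a trace on the
vector space `𝔤 × 𝔤`, where the pair `(x, y)` stands for the field `x^c + y^v` (`lieLift`).

The brackets of the frame are `[x^c, y^c] = [x, y]^c`, `[x^c, y^v] = [x, y]^v` and `[x^v, y^v] = 0`
(`mlieBracket_lieLift`). They are valid on any manifold `M` (`mlieBracket_liftSum`) and are computed
in the charts of `TM` induced by charts of `M`, where `X^c` is `(x, v) ↦ (X(x), DX(x) v)` and `X^v`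
is `(x, v) ↦ (0, X(x))` (`chartRep_completeLift`, `chartRep_verticalLift`). Both the independence of
these formulas from the chart and the bracket relations rest on the symmetry of second derivatives.

For an adapted pair `(U, b)` with `g(b, b) = 1` the bracket of `𝔤` is
`[x, y] = g(b, x) y - g(b, y) x` (`IsAdaptedPair.bracket_eq`). The Koszul formula then gives
explicit constant Christoffel symbols, `liftedGamma`. They are metric and have the right
antisymmetrization, so that by Koszul's uniqueness argument (`eq_of_metric_of_sub_swap`) they are
those of any Levi-Civita connection (`IsLeviCivita.apply_lieLift`).

The Ricci tensor is defined by means of arbitrary local extensions of tangent vectors. Expanding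
such an extension in the frame shows that the curvature depends only on its value at the point
(`curvature_eq_of_parallelization`), hence the Ricci tensor is the trace of the algebraic curvature
`gammaCurvature` (`ricci_eq_trace`). The traces are evaluated in the basis formed by the lifts of an
orthonormal basis of `𝔤` (`trace_gammaCurvature_liftedGamma`).
-/

noncomputable section

/-! ### Vector fields in a chart -/

section ChartRepresentation

open VectorField Topology

variable {E : Type*} [NormedAddCommGroup E] [NormedSpace ℝ E] {H : Type*} [TopologicalSpace H]
  {I : ModelWithCorners ℝ E H} {M : Type*} [TopologicalSpace M] [ChartedSpace H M]

/-- The vector field `X` in the chart at `c`, a function on the model space. -/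
def chartRep [IsManifold I 1 M] (c : M) (X : ∀ q : M, TangentSpace I q) (x : E) : E :=
  tangentCoordChange I ((extChartAt I c).symm x) c ((extChartAt I c).symm x)
    (X ((extChartAt I c).symm x))

theorem chartRep_extChartAt [IsManifold I 1 M] {c q : M} (hq : q ∈ (extChartAt I c).source)
    (X : ∀ q : M, TangentSpace I q) :
    chartRep c X (extChartAt I c q) = tangentCoordChange I q c q (X q) := by
  unfold chartRep
  rw [(extChartAt I c).left_inv hq]

theorem chartRep_extChartAt_self [IsManifold I 1 M] (c : M) (X : ∀ q : M, TangentSpace I q) :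
    chartRep c X (extChartAt I c c) = X c := by
  rw [chartRep_extChartAt (mem_extChartAt_source c)]
  exact tangentCoordChange_self (mem_extChartAt_source c)

theorem contDiffOn_chartRep [IsManifold I ∞ M] [I.Boundaryless] (c : M)
    {X : ∀ q : M, TangentSpace I q} {n : ℕ∞}
    (hX : ContMDiff I I.tangent n (fun q => (⟨q, X q⟩ : TangentBundle I M))) :
    ContDiffOn ℝ n (chartRep c X) (extChartAt I c).target := by
  have : IsManifold I (n + 1) M := IsManifold.of_le (n := ∞) (by exact_mod_cast le_top)
  have : ContMDiffVectorBundle n E (TangentSpace I : M → Type _) I :=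
    TangentBundle.contMDiffVectorBundle
  have h1 := (trivializationAt E (TangentSpace I) c).contMDiffOn_section_baseSet_iff.1
    (hX.contMDiffOn (s := (trivializationAt E (TangentSpace I) c).baseSet))
  have h2 : ContMDiffOn 𝓘(ℝ, E) I n (extChartAt I c).symm (extChartAt I c).target :=
    contMDiffOn_extChartAt_symm c
  rw [← contMDiffOn_iff_contDiffOn]
  refine h1.comp h2 fun x hx => ?_
  have := (extChartAt I c).map_target hx
  rwa [extChartAt_source] at this

theorem mfderiv_extChartAt_eq_tangentCoordChange [IsManifold I 1 M] {c q : M}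
    (hq : q ∈ (extChartAt I c).source) :
    mfderiv I 𝓘(ℝ, E) (extChartAt I c) q = tangentCoordChange I q c q := by
  rw [extChartAt_source] at hq
  exact (mdifferentiableAt_extChartAt (I := I) hq).mfderiv

/-- The chart representation is the pullback along the inverse of the chart, so that the naturality
of brackets under pullbacks applies to it. -/
theorem mpullback_symm_eq_chartRep [IsManifold I 1 M] [I.Boundaryless] {c : M}
    (X : ∀ q : M, TangentSpace I q) {x : E} (hx : x ∈ (extChartAt I c).target) :
    mpullback 𝓘(ℝ, E) I (extChartAt I c).symm X x = chartRep c X x := by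
  have h1 := mfderivWithin_extChartAt_symm_comp_mfderiv_extChartAt hx
  have h2 := mfderiv_extChartAt_comp_mfderivWithin_extChartAt_symm hx
  rw [I.range_eq_univ, mfderivWithin_univ] at h1 h2
  rw [mpullback_apply, ContinuousLinearMap.inverse_eq h1 h2,
    mfderiv_extChartAt_eq_tangentCoordChange ((extChartAt I c).map_target hx)]
  rfl

theorem chartRep_mlieBracket [CompleteSpace E] [IsManifold I ∞ M] [I.Boundaryless] {c : M}
    {X Y : ∀ q : M, TangentSpace I q} {x : E} (hx : x ∈ (extChartAt I c).target)
    (hX : FieldDifferentiableAt X ((extChartAt I c).symm x))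
    (hY : FieldDifferentiableAt Y ((extChartAt I c).symm x)) :
    chartRep c (mlieBracket I X Y) x = lieBracket ℝ (chartRep c X) (chartRep c Y) x := by
  have : IsManifold I (minSmoothness ℝ 2) M := by
    simp only [minSmoothness_of_isRCLikeNormedField]
    exact IsManifold.of_le (n := ∞) ENat.LEInfty.out
  have hn : (extChartAt I c).target ∈ 𝓝 x := extChartAt_target_mem_nhds' hx
  have hs : ContMDiffAt 𝓘(ℝ, E) I ∞ (extChartAt I c).symm x :=
    (contMDiffOn_extChartAt_symm c).contMDiffAt hn
  rw [← mpullback_symm_eq_chartRep _ hx, mpullback_mlieBracket hX hY hs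
    (by simp only [minSmoothness_of_isRCLikeNormedField]; exact ENat.LEInfty.out)]
  have e : ∀ Z : ∀ q : M, TangentSpace I q,
      mpullback 𝓘(ℝ, E) I (extChartAt I c).symm Z =ᶠ[𝓝 x] chartRep c Z := fun Z =>
    Filter.eventually_of_mem hn fun y hy => mpullback_symm_eq_chartRep Z hy
  rw [← mlieBracketWithin_univ, mlieBracketWithin_eq_lieBracketWithin]
  refine (congrFun lieBracketWithin_univ x).trans ?_
  exact (e X).lieBracket_vectorField_eq (e Y)

/-- A vector field is differentiable at `c` once its representation in the chart at `c` is
differentiable at the image of `c`. -/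
theorem fieldDifferentiableAt_of_chartRep [IsManifold I ∞ M] [I.Boundaryless] {c : M}
    {X : ∀ q : M, TangentSpace I q}
    (h : DifferentiableAt ℝ (chartRep c X) (extChartAt I c c)) : FieldDifferentiableAt X c := by
  have hc : c ∈ (trivializationAt E (TangentSpace I) c).baseSet :=
    FiberBundle.mem_baseSet_trivializationAt' c
  refine ((trivializationAt E (TangentSpace I) c).mdifferentiableAt_section_iff I X hc).2 ?_
  have h1 : MDifferentiableAt I 𝓘(ℝ, E) (chartRep c X ∘ extChartAt I c) c :=
    h.mdifferentiableAt.comp c (mdifferentiableAt_extChartAt (mem_chart_source H c))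
  refine h1.congr_of_eventuallyEq ?_
  filter_upwards [extChartAt_source_mem_nhds (I := I) c] with q hq
  exact (chartRep_extChartAt hq X).symm

end ChartRepresentation

/-! ### Complete and vertical lifts in the charts of the tangent bundle -/

section TangentLifts

open VectorField Topology

variable {E : Type*} [NormedAddCommGroup E] [NormedSpace ℝ E] {H : Type*} [TopologicalSpace H]
  {I : ModelWithCorners ℝ E H} {M : Type*} [TopologicalSpace M] [ChartedSpace H M]

theorem extChartAt_tangent_apply [IsManifold I 1 M] (p q : TangentBundle I M) :
    extChartAt I.tangent p q =
      (extChartAt I p.1 q.1, tangentCoordChange I q.1 p.1 q.1 q.2) := rfl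

theorem extChartAt_tangent_source [IsManifold I 1 M] {p q : TangentBundle I M} :
    q ∈ (extChartAt I.tangent p).source ↔ q.1 ∈ (extChartAt I p.1).source := by
  rw [extChartAt_source, extChartAt_source]
  exact TangentBundle.mem_chart_source_iff q p

theorem tangentCoordChange_eq_fderiv [IsManifold I 1 M] [I.Boundaryless] (a b z : M) :
    tangentCoordChange I a b z =
      fderiv ℝ (extChartAt I b ∘ (extChartAt I a).symm) (extChartAt I a z) := by
  rw [tangentCoordChange_def, I.range_eq_univ, fderivWithin_univ]

/-- The representations of a vector field in two charts are related by the derivative of the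
transition map. -/
theorem chartRep_transition [IsManifold I 1 M] [I.Boundaryless] (X : ∀ q : M, TangentSpace I q)
    {a b : M} {x : E} (hx : x ∈ (extChartAt I a).target)
    (hb : (extChartAt I a).symm x ∈ (extChartAt I b).source) :
    chartRep b X ((extChartAt I b ∘ (extChartAt I a).symm) x) =
      fderiv ℝ (extChartAt I b ∘ (extChartAt I a).symm) x (chartRep a X x) := by
  have h := (extChartAt I a).map_target hx
  have e := tangentCoordChange_eq_fderiv (I := I) a b ((extChartAt I a).symm x)
  rw [(extChartAt I a).right_inv hx] at e
  rw [Function.comp_apply, chartRep_extChartAt hb, ← e]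
  exact (tangentCoordChange_comp ⟨⟨mem_extChartAt_source _, h⟩, hb⟩).symm

theorem contDiffAt_transition [IsManifold I ∞ M] [I.Boundaryless] {a b : M} {x : E}
    (hx : x ∈ (extChartAt I a).target) (hb : (extChartAt I a).symm x ∈ (extChartAt I b).source) :
    ContDiffAt ℝ ∞ (extChartAt I b ∘ (extChartAt I a).symm) x := by
  have h := contDiffWithinAt_ext_coord_change (I := I) (n := ∞) b a (y := x) ⟨hx, hb⟩
  rwa [I.range_eq_univ, contDiffWithinAt_univ] at h

theorem extChartAt_tangent_transition [IsManifold I 1 M] [I.Boundaryless]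
    {a b : TangentBundle I M} {y : E × E} (hy : y ∈ (extChartAt I.tangent a).target)
    (hb : (extChartAt I a.1).symm y.1 ∈ (extChartAt I b.1).source) :
    (extChartAt I.tangent b ∘ (extChartAt I.tangent a).symm) y =
      ((extChartAt I b.1 ∘ (extChartAt I a.1).symm) y.1,
        fderiv ℝ (extChartAt I b.1 ∘ (extChartAt I a.1).symm) y.1 y.2) := by
  have h := (extChartAt I.tangent a).map_target hy
  have hr := (extChartAt I.tangent a).right_inv hy
  set q := (extChartAt I.tangent a).symm y with hq
  have hq1 : q.1 = (extChartAt I a.1).symm y.1 := rfl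
  rw [extChartAt_tangent_source] at h
  rw [← hq1] at hb
  rw [extChartAt_tangent_apply] at hr
  have h1 : extChartAt I a.1 q.1 = y.1 := congrArg Prod.fst hr
  have h2 : tangentCoordChange I q.1 a.1 q.1 q.2 = y.2 := congrArg Prod.snd hr
  have e := tangentCoordChange_eq_fderiv (I := I) a.1 b.1 q.1
  rw [h1] at e
  rw [Function.comp_apply, ← hq, extChartAt_tangent_apply, Function.comp_apply, ← hq1]
  refine Prod.ext rfl ?_
  change tangentCoordChange I q.1 b.1 q.1 q.2 = _
  rw [← e, ← h2]
  exact (tangentCoordChange_comp ⟨⟨mem_extChartAt_source _, h⟩, hb⟩).symm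

/-- The differential of `(x, v) ↦ (τ x, Dτ(x) v)`. -/
theorem hasFDerivAt_tangentMap {F : Type*} [NormedAddCommGroup F] [NormedSpace ℝ F]
    {τ : E → F} {y : E × E} (h : ContDiffAt ℝ 2 τ y.1) :
    HasFDerivAt (fun z : E × E => (τ z.1, fderiv ℝ τ z.1 z.2))
      (((fderiv ℝ τ y.1).comp (ContinuousLinearMap.fst ℝ E E)).prod
        (((fderiv ℝ (fderiv ℝ τ) y.1).comp (ContinuousLinearMap.fst ℝ E E)).flip y.2 +
          (fderiv ℝ τ y.1).comp (ContinuousLinearMap.snd ℝ E E))) y := by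
  have h1 : HasFDerivAt τ (fderiv ℝ τ y.1) y.1 :=
    (h.differentiableAt (by norm_num)).hasFDerivAt
  have h2 : HasFDerivAt (fderiv ℝ τ) (fderiv ℝ (fderiv ℝ τ) y.1) y.1 :=
    ((h.fderiv_right (m := 1) le_rfl).differentiableAt (by norm_num)).hasFDerivAt
  have hf : HasFDerivAt (Prod.fst : E × E → E) (ContinuousLinearMap.fst ℝ E E) y := hasFDerivAt_fst
  have hs : HasFDerivAt (Prod.snd : E × E → E) (ContinuousLinearMap.snd ℝ E E) y := hasFDerivAt_snd
  refine (h1.comp y hf).prodMk ?_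
  have := (h2.comp y hf).clm_apply hs
  rwa [add_comm] at this

theorem contDiffAt_chartRep [IsManifold I ∞ M] [I.Boundaryless] {c : M}
    {X : ∀ q : M, TangentSpace I q} {n : ℕ∞}
    (hX : ContMDiff I I.tangent n (fun q => (⟨q, X q⟩ : TangentBundle I M))) {x : E}
    (hx : x ∈ (extChartAt I c).target) : ContDiffAt ℝ n (chartRep c X) x :=
  (contDiffOn_chartRep c hX).contDiffAt (extChartAt_target_mem_nhds' hx)

/-- The complete lift at a point `p` of `TM`, read in the chart of `M` at the foot of `p`. -/
theorem completeLift_apply [IsManifold I ∞ M] [I.Boundaryless] {X : ∀ q : M, TangentSpace I q}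
    (hX : ContMDiff I I.tangent 1 (fun q => (⟨q, X q⟩ : TangentBundle I M)))
    (p : TangentBundle I M) :
    completeLift X p =
      ((X p.1, fderiv ℝ (chartRep p.1 X) (extChartAt I p.1 p.1) p.2) : E × E) := by
  have hd : MDifferentiableAt I I.tangent (fun q => (⟨q, X q⟩ : TangentBundle I M)) p.1 :=
    (hX p.1).mdifferentiableAt (by norm_num)
  have hD : DifferentiableAt ℝ (chartRep p.1 X) (extChartAt I p.1 p.1) :=
    (contDiffAt_chartRep (n := 1) hX (mem_extChartAt_target p.1)).differentiableAt (by norm_num)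
  -- in charts the section `q ↦ (q, X q)` is `x ↦ (x, X(x))`
  have key : HasFDerivAt (writtenInExtChartAt I I.tangent p.1
      (fun q => (⟨q, X q⟩ : TangentBundle I M)))
      ((ContinuousLinearMap.id ℝ E).prod (fderiv ℝ (chartRep p.1 X) (extChartAt I p.1 p.1)))
      (extChartAt I p.1 p.1) := by
    refine ((hasFDerivAt_id _).prodMk hD.hasFDerivAt).congr_of_eventuallyEq ?_
    filter_upwards [extChartAt_target_mem_nhds (I := I) p.1] with x hx
    refine Prod.ext ?_ rfl
    exact (extChartAt I p.1).right_inv hx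
  have h2 := hd.mfderiv
  rw [I.range_eq_univ, fderivWithin_univ, key.fderiv] at h2
  unfold completeLift
  rw [h2]
  rfl

/-- Two vector fields `a`, `b` related by `τ` have related complete lifts: differentiating
`b ∘ τ = Dτ(a)` produces a second derivative of `τ`, which is symmetric. -/
theorem fderiv_tangentMap_complete {F : Type*} [NormedAddCommGroup F] [NormedSpace ℝ F]
    {τ : E → F} {x : E} (h : ContDiffAt ℝ 2 τ x) {a : E → E} {b : F → F}
    (ha : DifferentiableAt ℝ a x) (hb : DifferentiableAt ℝ b (τ x))
    (hrel : b ∘ τ =ᶠ[𝓝 x] fun z => fderiv ℝ τ z (a z)) (v : E) :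
    fderiv ℝ (fun z : E × E => (τ z.1, fderiv ℝ τ z.1 z.2)) (x, v) (a x, fderiv ℝ a x v) =
      (b (τ x), fderiv ℝ b (τ x) (fderiv ℝ τ x v)) := by
  have h1 : HasFDerivAt τ (fderiv ℝ τ x) x := (h.differentiableAt (by norm_num)).hasFDerivAt
  have h2 : HasFDerivAt (fderiv ℝ τ) (fderiv ℝ (fderiv ℝ τ) x) x :=
    ((h.fderiv_right (m := 1) le_rfl).differentiableAt (by norm_num)).hasFDerivAt
  have hval : b (τ x) = fderiv ℝ τ x (a x) := hrel.self_of_nhds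
  have hder := congrArg (fun L : E →L[ℝ] F => L v)
    (((hb.hasFDerivAt.comp x h1).congr_of_eventuallyEq hrel.symm).unique
      (h2.clm_apply ha.hasFDerivAt))
  have hsymm : fderiv ℝ (fderiv ℝ τ) x v (a x) = fderiv ℝ (fderiv ℝ τ) x (a x) v :=
    (h.isSymmSndFDerivAt (by simp)).eq _ _
  rw [(hasFDerivAt_tangentMap (y := (x, v)) h).fderiv]
  simp only [ContinuousLinearMap.comp_apply, add_apply,
    ContinuousLinearMap.flip_apply] at hder
  refine Prod.ext hval.symm (Eq.trans ?_ hder.symm)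
  simp [hsymm, add_comm]

theorem fderiv_tangentMap_vertical {F : Type*} [NormedAddCommGroup F] [NormedSpace ℝ F]
    {τ : E → F} {x : E} (h : ContDiffAt ℝ 2 τ x) (v w : E) :
    fderiv ℝ (fun z : E × E => (τ z.1, fderiv ℝ τ z.1 z.2)) (x, v) (0, w) =
      (0, fderiv ℝ τ x w) := by
  rw [(hasFDerivAt_tangentMap (y := (x, v)) h).fderiv]
  simp

/-- The charts of `TM` change by the tangent maps of the transition maps of `M`. -/
theorem tangentCoordChange_tangent [IsManifold I ∞ M] [I.Boundaryless]
    {c p : TangentBundle I M} (hp : p.1 ∈ (extChartAt I c.1).source) :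
    tangentCoordChange I.tangent p c p =
      fderiv ℝ (fun z : E × E =>
          ((extChartAt I c.1 ∘ (extChartAt I p.1).symm) z.1,
            fderiv ℝ (extChartAt I c.1 ∘ (extChartAt I p.1).symm) z.1 z.2))
        ((extChartAt I p.1 p.1, p.2) : E × E) := by
  have hself : extChartAt I.tangent p p = ((extChartAt I p.1 p.1, p.2) : E × E) :=
    Prod.ext rfl (tangentCoordChange_self (mem_extChartAt_source p.1))
  rw [tangentCoordChange_eq_fderiv, ← hself]
  refine Filter.EventuallyEq.fderiv_eq ?_
  have h2 : ∀ᶠ z : E × E in 𝓝 (extChartAt I.tangent p p), (extChartAt I p.1).symm z.1 ∈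
      (extChartAt I c.1).source := by
    have h3 : ∀ᶠ x in 𝓝 (extChartAt I p.1 p.1), (extChartAt I p.1).symm x ∈
        (extChartAt I c.1).source := by
      refine (continuousAt_extChartAt_symm p.1).preimage_mem_nhds ?_
      rw [extChartAt_to_inv]
      exact extChartAt_source_mem_nhds' hp
    exact (continuous_fst.tendsto (extChartAt I.tangent p p : E × E)).eventually h3
  filter_upwards [extChartAt_target_mem_nhds (I := I.tangent) p, h2] with z hz1 hz2
  exact extChartAt_tangent_transition hz1 hz2

theorem extChartAt_tangent_eq_fderiv [IsManifold I 1 M] [I.Boundaryless]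
    (c p : TangentBundle I M) :
    extChartAt I.tangent c p = ((extChartAt I c.1 p.1,
      fderiv ℝ (extChartAt I c.1 ∘ (extChartAt I p.1).symm) (extChartAt I p.1 p.1) p.2) :
        E × E) := by
  rw [extChartAt_tangent_apply, tangentCoordChange_eq_fderiv]

/-- In the chart of `TM` induced by any chart of `M`, the complete lift of `X` is
`(x, v) ↦ (X(x), DX(x) v)`. -/
theorem chartRep_completeLift [IsManifold I ∞ M] [I.Boundaryless]
    {X : ∀ q : M, TangentSpace I q}
    (hX : ContMDiff I I.tangent 1 (fun q => (⟨q, X q⟩ : TangentBundle I M)))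
    (c : TangentBundle I M) {y : E × E} (hy : y ∈ (extChartAt I.tangent c).target) :
    chartRep c (completeLift X) y =
      (chartRep c.1 X y.1, fderiv ℝ (chartRep c.1 X) y.1 y.2) := by
  obtain ⟨p, hpc, rfl⟩ : ∃ p ∈ (extChartAt I.tangent c).source, extChartAt I.tangent c p = y :=
    ⟨_, (extChartAt I.tangent c).map_target hy, (extChartAt I.tangent c).right_inv hy⟩
  rw [chartRep_extChartAt hpc, completeLift_apply hX]
  rw [extChartAt_tangent_source] at hpc
  have hxt := mem_extChartAt_target (I := I) p.1
  have hcx : (extChartAt I c.1 ∘ (extChartAt I p.1).symm) (extChartAt I p.1 p.1) =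
      extChartAt I c.1 p.1 := by rw [Function.comp_apply, extChartAt_to_inv]
  have hpc' : (extChartAt I p.1).symm (extChartAt I p.1 p.1) ∈ (extChartAt I c.1).source := by
    rwa [extChartAt_to_inv]
  have hτ : ContDiffAt ℝ 2 (extChartAt I c.1 ∘ (extChartAt I p.1).symm)
      (extChartAt I p.1 p.1) := (contDiffAt_transition hxt hpc').of_le ENat.LEInfty.out
  have ha : DifferentiableAt ℝ (chartRep p.1 X) (extChartAt I p.1 p.1) :=
    (contDiffAt_chartRep (n := 1) hX hxt).differentiableAt (by norm_num)
  have hb : DifferentiableAt ℝ (chartRep c.1 X)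
      ((extChartAt I c.1 ∘ (extChartAt I p.1).symm) (extChartAt I p.1 p.1)) :=
    (contDiffAt_chartRep (n := 1) hX
      (hcx ▸ (extChartAt I c.1).map_source hpc)).differentiableAt (by norm_num)
  have hrel : chartRep c.1 X ∘ (extChartAt I c.1 ∘ (extChartAt I p.1).symm)
      =ᶠ[𝓝 (extChartAt I p.1 p.1)]
        fun z => fderiv ℝ (extChartAt I c.1 ∘ (extChartAt I p.1).symm) z (chartRep p.1 X z) := by
    filter_upwards [extChartAt_target_mem_nhds (I := I) p.1,
      (continuousAt_extChartAt_symm (I := I) p.1).preimage_mem_nhds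
        (extChartAt_source_mem_nhds' hpc')] with z hz1 hz2
    exact chartRep_transition X hz1 hz2
  have key := fderiv_tangentMap_complete hτ ha hb hrel p.2
  rw [hcx, chartRep_extChartAt_self] at key
  rw [extChartAt_tangent_eq_fderiv c p, tangentCoordChange_tangent hpc]
  exact key

/-- In the chart of `TM` induced by any chart of `M`, the vertical lift of `X` is
`(x, v) ↦ (0, X(x))`. -/
theorem chartRep_verticalLift [IsManifold I ∞ M] [I.Boundaryless]
    (X : ∀ q : M, TangentSpace I q)
    (c : TangentBundle I M) {y : E × E} (hy : y ∈ (extChartAt I.tangent c).target) :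
    chartRep c (verticalLift X) y = ((0, chartRep c.1 X y.1) : E × E) := by
  have : IsManifold I 2 M := IsManifold.of_le (n := ∞) ENat.LEInfty.out
  obtain ⟨p, hpc, rfl⟩ : ∃ p ∈ (extChartAt I.tangent c).source, extChartAt I.tangent c p = y :=
    ⟨_, (extChartAt I.tangent c).map_target hy, (extChartAt I.tangent c).right_inv hy⟩
  rw [chartRep_extChartAt hpc, verticalLift_eq]
  rw [extChartAt_tangent_source] at hpc
  have hxt := mem_extChartAt_target (I := I) p.1
  have hpc' : (extChartAt I p.1).symm (extChartAt I p.1 p.1) ∈ (extChartAt I c.1).source := by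
    rwa [extChartAt_to_inv]
  have hτ : ContDiffAt ℝ 2 (extChartAt I c.1 ∘ (extChartAt I p.1).symm)
      (extChartAt I p.1 p.1) := (contDiffAt_transition hxt hpc').of_le ENat.LEInfty.out
  have key := fderiv_tangentMap_vertical hτ p.2 (X p.1)
  have hval := chartRep_transition X hxt hpc'
  rw [Function.comp_apply, extChartAt_to_inv, chartRep_extChartAt_self] at hval
  rw [tangentCoordChange_tangent hpc]
  refine key.trans (Prod.ext rfl ?_)
  exact hval.symm

end TangentLifts

/-! ### Brackets of lifts -/

section LiftBrackets

open VectorField Topology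

variable {E : Type*} [NormedAddCommGroup E] [NormedSpace ℝ E] {H : Type*} [TopologicalSpace H]
  {I : ModelWithCorners ℝ E H} {M : Type*} [TopologicalSpace M] [ChartedSpace H M]

/-- The derivative of `a^c + a'^v` on a vector space. -/
theorem hasFDerivAt_lift {a a' : E → E} {y : E × E} (ha : ContDiffAt ℝ 2 a y.1)
    (ha' : DifferentiableAt ℝ a' y.1) :
    HasFDerivAt (fun z : E × E => (a z.1, fderiv ℝ a z.1 z.2 + a' z.1))
      (((fderiv ℝ a y.1).comp (ContinuousLinearMap.fst ℝ E E)).prod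
        (((fderiv ℝ (fderiv ℝ a) y.1).comp (ContinuousLinearMap.fst ℝ E E)).flip y.2 +
          (fderiv ℝ a y.1).comp (ContinuousLinearMap.snd ℝ E E) +
          (fderiv ℝ a' y.1).comp (ContinuousLinearMap.fst ℝ E E))) y := by
  have hf : HasFDerivAt (Prod.fst : E × E → E) (ContinuousLinearMap.fst ℝ E E) y := hasFDerivAt_fst
  have h1 := (hasFDerivAt_tangentMap ha).fst
  have h2 := (hasFDerivAt_tangentMap ha).snd
  exact h1.prodMk (h2.add (ha'.hasFDerivAt.comp y hf))

/-- The brackets of lifts on a vector space: `[a^c + a'^v, b^c + b'^v]` is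
`[a, b]^c + ([a', b] + [a, b'])^v`. -/
theorem lieBracket_lift {a a' b b' : E → E} {y : E × E} (ha : ContDiffAt ℝ 2 a y.1)
    (ha' : DifferentiableAt ℝ a' y.1) (hb : ContDiffAt ℝ 2 b y.1)
    (hb' : DifferentiableAt ℝ b' y.1) :
    lieBracket ℝ (fun z : E × E => (a z.1, fderiv ℝ a z.1 z.2 + a' z.1))
        (fun z : E × E => (b z.1, fderiv ℝ b z.1 z.2 + b' z.1)) y =
      (lieBracket ℝ a b y.1, fderiv ℝ (lieBracket ℝ a b) y.1 y.2 +
        (lieBracket ℝ a' b y.1 + lieBracket ℝ a b' y.1)) := by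
  have d1 : ∀ {f : E → E}, ContDiffAt ℝ 2 f y.1 → DifferentiableAt ℝ f y.1 :=
    fun h => h.differentiableAt (by norm_num)
  have d2 : ∀ {f : E → E}, ContDiffAt ℝ 2 f y.1 → DifferentiableAt ℝ (fderiv ℝ f) y.1 :=
    fun h => (h.fderiv_right (m := 1) le_rfl).differentiableAt (by norm_num)
  have hsa : fderiv ℝ (fderiv ℝ a) y.1 (b y.1) y.2 = fderiv ℝ (fderiv ℝ a) y.1 y.2 (b y.1) :=
    (ha.isSymmSndFDerivAt (by simp)).eq _ _
  have hsb : fderiv ℝ (fderiv ℝ b) y.1 (a y.1) y.2 = fderiv ℝ (fderiv ℝ b) y.1 y.2 (a y.1) :=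
    (hb.isSymmSndFDerivAt (by simp)).eq _ _
  have hD : fderiv ℝ (lieBracket ℝ a b) y.1 =
      ((fderiv ℝ b y.1).comp (fderiv ℝ a y.1) + (fderiv ℝ (fderiv ℝ b) y.1).flip (a y.1)) -
      ((fderiv ℝ a y.1).comp (fderiv ℝ b y.1) + (fderiv ℝ (fderiv ℝ a) y.1).flip (b y.1)) :=
    (((d2 hb).hasFDerivAt.clm_apply (d1 ha).hasFDerivAt).sub
      ((d2 ha).hasFDerivAt.clm_apply (d1 hb).hasFDerivAt)).fderiv
  simp only [lieBracket_eq] at hD ⊢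
  rw [(hasFDerivAt_lift ha ha').fderiv, (hasFDerivAt_lift hb hb').fderiv, hD]
  refine Prod.ext (by simp) ?_
  simp [hsa, hsb]
  abel

/-- The vector field `X^c + Y^v` on the tangent bundle. -/
def liftSum [IsManifold I 1 M] (X Y : ∀ q : M, TangentSpace I q) (p : TangentBundle I M) :
    TangentSpace I.tangent p :=
  completeLift X p + verticalLift Y p

variable [IsManifold I ∞ M] [I.Boundaryless] {X Y X' Y' : ∀ q : M, TangentSpace I q}

theorem completeLift_add
    (hX : ContMDiff I I.tangent 1 (fun q => (⟨q, X q⟩ : TangentBundle I M)))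
    (hY : ContMDiff I I.tangent 1 (fun q => (⟨q, Y q⟩ : TangentBundle I M)))
    (p : TangentBundle I M) :
    completeLift (X + Y) p = completeLift X p + completeLift Y p := by
  have hp := mem_extChartAt_target (I := I) p.1
  have e : chartRep p.1 (X + Y) = chartRep p.1 X + chartRep p.1 Y :=
    funext fun x => map_add (tangentCoordChange I _ p.1 _) _ _
  have h1 := (contDiffAt_chartRep (n := 1) hX hp).differentiableAt (by norm_num)
  have h2 := (contDiffAt_chartRep (n := 1) hY hp).differentiableAt (by norm_num)
  rw [completeLift_apply (hX.add_section hY), completeLift_apply hX, completeLift_apply hY, e,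
    fderiv_add h1 h2]
  rfl

theorem completeLift_const_smul
    (hX : ContMDiff I I.tangent 1 (fun q => (⟨q, X q⟩ : TangentBundle I M))) (r : ℝ)
    (p : TangentBundle I M) : completeLift (r • X) p = r • completeLift X p := by
  have hp := mem_extChartAt_target (I := I) p.1
  have e : chartRep p.1 (r • X) = r • chartRep p.1 X :=
    funext fun x => map_smul (tangentCoordChange I _ p.1 _) _ _
  have h1 := (contDiffAt_chartRep (n := 1) hX hp).differentiableAt (by norm_num)
  rw [completeLift_apply hX.const_smul_section, completeLift_apply hX, e,
    fderiv_const_smul h1 r]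
  rfl

theorem chartRep_liftSum
    (hX : ContMDiff I I.tangent 1 (fun q => (⟨q, X q⟩ : TangentBundle I M)))
    (c : TangentBundle I M) {y : E × E} (hy : y ∈ (extChartAt I.tangent c).target) :
    chartRep c (liftSum X Y) y =
      (chartRep c.1 X y.1, fderiv ℝ (chartRep c.1 X) y.1 y.2 + chartRep c.1 Y y.1) := by
  have h : chartRep c (liftSum X Y) y =
      chartRep c (completeLift X) y + chartRep c (verticalLift Y) y :=
    map_add (tangentCoordChange I.tangent _ c _) _ _
  rw [h, chartRep_completeLift hX c hy, chartRep_verticalLift Y c hy]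
  simp

theorem chartRep_liftSum_eventuallyEq
    (hX : ContMDiff I I.tangent 1 (fun q => (⟨q, X q⟩ : TangentBundle I M)))
    (c : TangentBundle I M) :
    chartRep c (liftSum X Y) =ᶠ[𝓝 (extChartAt I.tangent c c)] fun y : E × E =>
      (chartRep c.1 X y.1, fderiv ℝ (chartRep c.1 X) y.1 y.2 + chartRep c.1 Y y.1) :=
  Filter.eventually_of_mem (extChartAt_target_mem_nhds (I := I.tangent) c)
    fun _ hy => chartRep_liftSum hX c hy

theorem fieldDifferentiableAt_liftSum
    (hX : ContMDiff I I.tangent 2 (fun q => (⟨q, X q⟩ : TangentBundle I M)))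
    (hY : ContMDiff I I.tangent 1 (fun q => (⟨q, Y q⟩ : TangentBundle I M)))
    (p : TangentBundle I M) : FieldDifferentiableAt (I := I.tangent) (liftSum X Y) p := by
  have hp : (extChartAt I.tangent p p).1 ∈ (extChartAt I p.1).target :=
    mem_extChartAt_target p.1
  refine fieldDifferentiableAt_of_chartRep ?_
  refine DifferentiableAt.congr_of_eventuallyEq ?_
    (chartRep_liftSum_eventuallyEq (hX.of_le (by norm_num)) p)
  exact (hasFDerivAt_lift (contDiffAt_chartRep (n := 2) hX hp)
    ((contDiffAt_chartRep (n := 1) hY hp).differentiableAt (by norm_num))).differentiableAt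

/-- The brackets of complete and vertical lifts: `[X^c, Y^c] = [X, Y]^c`,
`[X^c, Y'^v] = [X, Y']^v` and `[X'^v, Y'^v] = 0`, in one formula. -/
theorem mlieBracket_liftSum [CompleteSpace E]
    (hX : ContMDiff I I.tangent 2 (fun q => (⟨q, X q⟩ : TangentBundle I M)))
    (hX' : ContMDiff I I.tangent 1 (fun q => (⟨q, X' q⟩ : TangentBundle I M)))
    (hY : ContMDiff I I.tangent 2 (fun q => (⟨q, Y q⟩ : TangentBundle I M)))
    (hY' : ContMDiff I I.tangent 1 (fun q => (⟨q, Y' q⟩ : TangentBundle I M)))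
    (p : TangentBundle I M) :
    mlieBracket I.tangent (liftSum X X') (liftSum Y Y') p =
      liftSum (mlieBracket I X Y) (mlieBracket I X' Y + mlieBracket I X Y') p := by
  have hp : (extChartAt I.tangent p p).1 ∈ (extChartAt I p.1).target :=
    mem_extChartAt_target p.1
  have hX1 := hX.of_le (m := 1) (by norm_num)
  have hY1 := hY.of_le (m := 1) (by norm_num)
  have hXY : ContMDiff I I.tangent 1
      (fun q => (⟨q, mlieBracket I X Y q⟩ : TangentBundle I M)) := by
    have : IsManifold I ((2 : ℕ∞) + 1) M := IsManifold.of_le (n := ∞) (by exact_mod_cast le_top)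
    have : IsManifold I (minSmoothness ℝ 2) M := by
      simp only [minSmoothness_of_isRCLikeNormedField]
      exact IsManifold.of_le (n := ∞) ENat.LEInfty.out
    exact fun q => ContMDiffAt.mlieBracket_vectorField (m := 1) (n := 2) (hX q) (hY q)
      (by simp only [minSmoothness_of_isRCLikeNormedField]; norm_num)
  have fd : ∀ {Z : ∀ q : M, TangentSpace I q},
      ContMDiff I I.tangent 1 (fun q => (⟨q, Z q⟩ : TangentBundle I M)) →
      ∀ q, FieldDifferentiableAt Z q := fun h q => (h q).mdifferentiableAt (by norm_num)
  have cd : ∀ {Z : ∀ q : M, TangentSpace I q},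
      ContMDiff I I.tangent 1 (fun q => (⟨q, Z q⟩ : TangentBundle I M)) →
      DifferentiableAt ℝ (chartRep p.1 Z) (extChartAt I.tangent p p).1 := fun h =>
    (contDiffAt_chartRep (n := 1) h hp).differentiableAt (by norm_num)
  have hbr : chartRep p.1 (mlieBracket I X Y) =ᶠ[𝓝 (extChartAt I.tangent p p).1]
      lieBracket ℝ (chartRep p.1 X) (chartRep p.1 Y) :=
    Filter.eventually_of_mem (extChartAt_target_mem_nhds' hp) fun x hx =>
      chartRep_mlieBracket hx (fd hX1 _) (fd hY1 _)
  have hadd : chartRep p.1 (mlieBracket I X' Y + mlieBracket I X Y')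
      (extChartAt I.tangent p p).1 = chartRep p.1 (mlieBracket I X' Y) (extChartAt I.tangent p p).1
        + chartRep p.1 (mlieBracket I X Y') (extChartAt I.tangent p p).1 :=
    map_add (tangentCoordChange I _ p.1 _) _ _
  rw [← chartRep_extChartAt_self p (mlieBracket I.tangent (liftSum X X') (liftSum Y Y')),
    ← chartRep_extChartAt_self p (liftSum (mlieBracket I X Y) _),
    chartRep_mlieBracket (mem_extChartAt_target p), chartRep_liftSum hXY p (mem_extChartAt_target p),
    (chartRep_liftSum_eventuallyEq hX1 p).lieBracket_vectorField_eq
      (chartRep_liftSum_eventuallyEq hY1 p), lieBracket_lift, hbr.fderiv_eq, hbr.self_of_nhds,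
    hadd, chartRep_mlieBracket hp (fd hX' _) (fd hY1 _),
    chartRep_mlieBracket hp (fd hX1 _) (fd hY' _)]
  · exact contDiffAt_chartRep (n := 2) hX hp
  · exact cd hX'
  · exact contDiffAt_chartRep (n := 2) hY hp
  · exact cd hY'
  · exact fieldDifferentiableAt_liftSum hX hX' _
  · exact fieldDifferentiableAt_liftSum hY hY' _

end LiftBrackets

/-! ### Curvature in a parallelization -/

section Parallelization

open Topology

variable {E : Type*} [NormedAddCommGroup E] [NormedSpace ℝ E] {H : Type*} [TopologicalSpace H]
  {I : ModelWithCorners ℝ E H} {M : Type*} [TopologicalSpace M] [ChartedSpace H M]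

/-- The coefficients of a differentiable vector field in a differentiable frame are
differentiable. -/
theorem exists_mdifferentiableAt_coeff [FiniteDimensional ℝ E] [IsManifold I 2 M] {ι : Type}
    [Fintype ι] {p : M} {s : ι → ∀ q : M, TangentSpace I q}
    (b : Module.Basis ι ℝ (TangentSpace I p)) (hb : ∀ i, b i = s i p)
    (hs : ∀ i, FieldDifferentiableAt (s i) p)
    {W : ∀ q : M, TangentSpace I q} (hW : FieldDifferentiableAt W p) :
    ∃ f : ι → M → ℝ, (∀ i, MDifferentiableAt I 𝓘(ℝ, ℝ) (f i) p) ∧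
      ∀ᶠ q in 𝓝 p, W q = ∑ i, f i q • s i q := by
  have hp : p ∈ (trivializationAt E (TangentSpace I) p).baseSet :=
    FiberBundle.mem_baseSet_trivializationAt' p
  set e := trivializationAt E (TangentSpace I : M → Type _) p with he
  have hσ := fun i => (e.mdifferentiableAt_section_iff I (s i) hp).1 (hs i)
  have hw := (e.mdifferentiableAt_section_iff I W hp).1 hW
  let pr : ι → (ι → ℝ) →L[ℝ] ℝ := fun i => ContinuousLinearMap.proj i
  let L : M → (ι → ℝ) →L[ℝ] E := fun q =>
    ∑ i, ContinuousLinearMap.smulRightL ℝ (ι → ℝ) E (pr i) (e (s i q)).2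
  have hL : ∀ q c, L q c = ∑ i, c i • (e (s i q)).2 := fun q c => by
    simp [L, pr]
  have hLd : MDifferentiableAt I 𝓘(ℝ, (ι → ℝ) →L[ℝ] E) L p := by
    have hi : ∀ i ∈ Finset.univ, MDifferentiableAt I 𝓘(ℝ, (ι → ℝ) →L[ℝ] E)
        (fun q => ContinuousLinearMap.smulRightL ℝ (ι → ℝ) E (pr i) (e (s i q)).2) p :=
      fun i _ => (ContinuousLinearMap.smulRightL ℝ (ι → ℝ) E
      (pr i)).differentiableAt.mdifferentiableAt.comp p (hσ i)
    have hsum : L = ∑ i, fun q =>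
        ContinuousLinearMap.smulRightL ℝ (ι → ℝ) E (pr i) (e (s i q)).2 := by
      ext1 q
      rw [Finset.sum_apply]
    rw [hsum]
    exact MDifferentiableAt.sum hi
  have hLe : ∀ (q : M) (hq : q ∈ e.baseSet) (c : ι → ℝ),
      L q c = e.linearEquivAt (R := ℝ) q hq (∑ i, c i • s i q) := by
    intro q hq c
    rw [hL, map_sum]
    exact Finset.sum_congr rfl fun i _ => (map_smul _ _ _).symm
  -- at `p` the map `L` is invertible, the `s i p` being a basis
  let A : (ι → ℝ) ≃L[ℝ] E :=
    (b.equivFun.symm.trans (e.linearEquivAt (R := ℝ) p hp)).toContinuousLinearEquiv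
  have hA : (A : (ι → ℝ) →L[ℝ] E) = L p := by
    ext1 c
    rw [hLe p hp]
    simp only [← hb]
    rw [← b.equivFun_symm_apply]
    rfl
  have hinv : MDifferentiableAt I 𝓘(ℝ, E →L[ℝ] (ι → ℝ)) (fun q => (L q).inverse) p := by
    have h1 : DifferentiableAt ℝ (ContinuousLinearMap.inverse : ((ι → ℝ) →L[ℝ] E) → _) (L p) := by
      rw [← hA]
      exact (contDiffAt_map_inverse A (n := 1)).differentiableAt (by norm_num)
    exact h1.mdifferentiableAt.comp p hLd
  have hg := hinv.clm_apply hw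
  refine ⟨fun i q => (L q).inverse (e (W q)).2 i, fun i => ?_, ?_⟩
  · exact (pr i).differentiableAt.mdifferentiableAt.comp p hg
  have hrange : ∀ᶠ q in 𝓝 p, L q ∈ Set.range ((↑) : ((ι → ℝ) ≃L[ℝ] E) → (ι → ℝ) →L[ℝ] E) := by
    refine hLd.continuousAt.preimage_mem_nhds ?_
    rw [← hA]
    exact ContinuousLinearEquiv.nhds A
  filter_upwards [hrange, e.open_baseSet.mem_nhds hp] with q ⟨B, hB⟩ hq
  apply (e.linearEquivAt (R := ℝ) q hq).injective
  rw [← hLe q hq, ← hB, ContinuousLinearMap.inverse_equiv]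
  exact (B.apply_symm_apply _).symm

/-- The Leibniz rule for the derivative of a combination `∑ i, f i • s i` with function
coefficients. -/
theorem CovariantDerivative.sum_smul_apply [IsManifold I 1 M] {ι : Type*}
    (nabla : CovariantDerivative I E (TangentSpace I : M → Type _)) (t : Finset ι)
    {f : ι → M → ℝ} {s : ι → ∀ q : M, TangentSpace I q} {p : M}
    (hf : ∀ i, MDifferentiableAt I 𝓘(ℝ, ℝ) (f i) p) (hs : ∀ i, FieldDifferentiableAt (s i) p)
    (v : TangentSpace I p) :
    FieldDifferentiableAt (fun q => ∑ i ∈ t, f i q • s i q) p ∧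
    nabla (fun q => ∑ i ∈ t, f i q • s i q) p v =
      ∑ i ∈ t, (f i p • nabla (s i) p v + mvfderiv I (f i) p v • s i p) := by
  classical
  induction t using Finset.induction_on with
  | empty =>
    refine ⟨?_, ?_⟩
    · simpa using! Bundle.mdifferentiableAt_zeroSection (IB := I) (F := E)
        (E := (TangentSpace I : M → Type _)) (x := p)
    · have h0 : (fun q => ∑ i ∈ ∅, f i q • s i q) = 0 := rfl
      rw [h0, nabla.zero]
      simp
  | insert i t hi ih =>
    have h1 := (hf i).smul_section (hs i)
    have e : (fun q => ∑ j ∈ insert i t, f j q • s j q) =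
        (f i • s i) + fun q => ∑ j ∈ t, f j q • s j q := by
      ext q
      rw [Finset.sum_insert hi]
      rfl
    rw [e, Finset.sum_insert hi, ← ih.2]
    refine ⟨mdifferentiableAt_add_section h1 ih.1, ?_⟩
    rw [nabla.isCovariantDerivativeOn.add h1 ih.1,
      nabla.isCovariantDerivativeOn.leibniz (hs i) (hf i)]
    rfl

/-- Let `F` be a parallelization with model space `k` in which a torsion free connection has
constant coefficients `Γ`. The curvature of fields `W`, `F x`, `F y`, with `W` merely differentiable,
is the algebraic curvature of `Γ` at the value of `W`: the derivatives of the coefficients of `W` in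
the frame cancel against those in `[W, F x]`. Equality of `[X, Y]` and `∇_X Y - ∇_Y X` lets the
brackets of `F` be expressed by `Γ`. -/
theorem curvature_eq_of_parallelization [FiniteDimensional ℝ E] [IsManifold I 2 M]
    {k : Type*} [AddCommGroup k] [Module ℝ k] [FiniteDimensional ℝ k]
    (F : k →ₗ[ℝ] ∀ q : M, TangentSpace I q) (hF : ∀ z q, FieldDifferentiableAt (F z) q)
    (nabla : CovariantDerivative I E (TangentSpace I : M → Type _)) (htor : nabla.torsion = 0)
    (Γ : k →ₗ[ℝ] k →ₗ[ℝ] k) (hΓ : ∀ a c q, nabla (F c) q (F a q) = F (Γ a c) q)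
    {p : M} (hbij : Function.Bijective fun z => F z p)
    {W : ∀ q : M, TangentSpace I q} (hW : FieldDifferentiableAt W p) {w : k} (hw : W p = F w p)
    (x y : k) :
    curvature nabla W (F x) (F y) p =
      F (Γ w (Γ x y) - Γ x (Γ w y) - Γ (Γ w x - Γ x w) y) p := by
  classical
  let B := Module.finBasis ℝ k
  let Fp : k →ₗ[ℝ] TangentSpace I p := LinearMap.proj p ∘ₗ F
  have hFp : ∀ z, Fp z = F z p := fun z => rfl
  obtain ⟨f, hf, hWf⟩ := exists_mdifferentiableAt_coeff (s := fun i => F (B i))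
    (B.map (LinearEquiv.ofBijective Fp hbij)) (fun i => B.map_apply _ i) (fun i => hF _ p) hW
  have hwf : w = ∑ i, f i p • B i := by
    refine hbij.1 ?_
    change Fp w = Fp _
    rw [hFp, ← hw, hWf.self_of_nhds, map_sum]
    simp [Fp]
  let dw : k := ∑ i, mvfderiv I (f i) p (F x p) • B i
  -- the derivative of `q ↦ F (Λ (w q)) q` for a linear map `Λ`, where `W q = F (w q) q`
  have key : ∀ (Λ : k →ₗ[ℝ] k) (Z : ∀ q : M, TangentSpace I q),
      (∀ᶠ q in 𝓝 p, Z q = ∑ i, f i q • F (Λ (B i)) q) → nabla Z p (F x p) =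
        F (Γ x (Λ w)) p + F (Λ dw) p := by
    intro Λ Z hZ
    obtain ⟨h1, h2⟩ := nabla.sum_smul_apply Finset.univ hf
      (fun i => hF (Λ (B i)) p) (F x p)
    have hZd : FieldDifferentiableAt Z p :=
      MDifferentiableAt.congr_of_eventuallyEq h1 (hZ.mono fun q hq => by simp only [hq])
    rw [nabla.isCovariantDerivativeOnUniv.congr_of_eventuallyEq hZd h1 Filter.univ_mem hZ, h2,
      hwf]
    simp only [hΓ]
    simp only [Finset.sum_add_distrib, ← hFp, dw, map_sum, map_smul]
  have h2 := key (Γ.flip y) (fun q => nabla (F y) q (W q)) (hWf.mono fun q hq => by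
    simp only [hq, map_sum, map_smul, hΓ, LinearMap.flip_apply])
  have h3 := key LinearMap.id W (hWf.mono fun q hq => by simpa using hq)
  have h4 := nabla.torsion_eq_zero_iff.1 htor hW (hF x p)
  have h5 : VectorField.mlieBracket I W (F x) p = F (Γ w x - Γ x w - dw) p := by
    rw [← h4, h3, hw, hΓ]
    simp only [← hFp, map_sub, LinearMap.id_apply]
    exact sub_add_eq_sub_sub _ _ _
  have h1 : nabla (fun q => nabla (F y) q (F x q)) p (W p) = F (Γ w (Γ x y)) p := by
    simp only [hΓ, hw]
  rw [curvature, h1, h2, h5, hΓ]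
  simp only [← hFp, map_sub, LinearMap.flip_apply, LinearMap.sub_apply]
  abel

/-- The Ricci tensor in a parallelization with constant connection coefficients `Γ` is the trace of
the algebraic curvature of `Γ`. -/
theorem ricci_eq_trace [FiniteDimensional ℝ E] [IsManifold I 2 M]
    {k : Type*} [AddCommGroup k] [Module ℝ k] [FiniteDimensional ℝ k]
    (F : k →ₗ[ℝ] ∀ q : M, TangentSpace I q) (hF : ∀ z q, FieldDifferentiableAt (F z) q)
    (nabla : CovariantDerivative I E (TangentSpace I : M → Type _)) (htor : nabla.torsion = 0)
    (Γ : k →ₗ[ℝ] k →ₗ[ℝ] k) (hΓ : ∀ a c q, nabla (F c) q (F a q) = F (Γ a c) q)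
    {p : M} (hbij : Function.Bijective fun z => F z p) (x y : k)
    (R : k →ₗ[ℝ] k) (hR : ∀ w, R w = Γ w (Γ x y) - Γ x (Γ w y) - Γ (Γ w x - Γ x w) y) :
    ricci nabla (F x) (F y) p = LinearMap.trace ℝ k R := by
  let Fp : k →ₗ[ℝ] TangentSpace I p := LinearMap.proj p ∘ₗ F
  let A : k ≃ₗ[ℝ] TangentSpace I p := LinearEquiv.ofBijective Fp hbij
  let e : Module.Basis (Fin (Module.finrank ℝ E)) ℝ (TangentSpace I p) := Module.finBasis ℝ E
  have h : ∀ v : TangentSpace I p,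
      curvature nabla (FiberBundle.extend E v) (F x) (F y) p = A.conj R v := by
    intro v
    rw [curvature_eq_of_parallelization F hF nabla htor Γ hΓ hbij (w := A.symm v)
      (FiberBundle.mdifferentiableAt_extend ..), ← hR]
    · rfl
    · exact (FiberBundle.extend_apply_self E v).trans (A.apply_symm_apply v).symm
  have h2 : ricci nabla (F x) (F y) p = ∑ i, e.repr (A.conj R (e i)) i :=
    Finset.sum_congr rfl fun i _ => by rw [h]
  rw [h2, ← LinearMap.trace_conj' R A, LinearMap.trace_eq_matrix_trace ℝ e, Matrix.trace]
  simp [LinearMap.toMatrix_apply]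

end Parallelization

/-! ### The lifted connection on the Lie algebra -/

section LiftedConnection

variable {V : Type*} [AddCommGroup V] [Module ℝ V]

/-- The Christoffel symbols, given by the Koszul formula, of the Levi-Civita connection of the
lifted metric in the frame of lifts of left invariant fields: here `B` is the inner product on the
Lie algebra `V`, in which `[x, y] = B(b, x) y - B(b, y) x`, and a pair `(x, y)` stands for
`x^c + y^v`. -/
def liftedGamma (B : V →ₗ[ℝ] V →ₗ[ℝ] ℝ) (b : V) : V × V →ₗ[ℝ] V × V →ₗ[ℝ] V × V :=
  LinearMap.mk₂ ℝ
    (fun a c =>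
      (-(B b c.1 • a.1) + (B a.1 c.1 + B a.2 c.2) • b
          - (1 / 2 : ℝ) • (B b c.2 • a.2 + B b a.2 • c.2),
        -(B b c.1 • a.2) + (1 / 2 : ℝ) • (B b a.2 • c.1 - B b c.2 • a.1)
          + ((1 / 2 : ℝ) * (B c.1 a.2 + B a.1 c.2)) • b))
    (fun a a' c => by
      refine Prod.ext ?_ ?_ <;> simp <;> module)
    (fun r a c => by
      refine Prod.ext ?_ ?_ <;> simp <;> module)
    (fun a c c' => by
      refine Prod.ext ?_ ?_ <;> simp <;> module)
    (fun r a c => by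
      refine Prod.ext ?_ ?_ <;> simp <;> module)

theorem liftedGamma_apply (B : V →ₗ[ℝ] V →ₗ[ℝ] ℝ) (b : V) (a c : V × V) :
    liftedGamma B b a c =
      (-(B b c.1 • a.1) + (B a.1 c.1 + B a.2 c.2) • b
          - (1 / 2 : ℝ) • (B b c.2 • a.2 + B b a.2 • c.2),
        -(B b c.1 • a.2) + (1 / 2 : ℝ) • (B b a.2 • c.1 - B b c.2 • a.1)
          + ((1 / 2 : ℝ) * (B c.1 a.2 + B a.1 c.2)) • b) := rfl

/-- The connection `liftedGamma` is torsion free: the right hand side is the bracket of the lifts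
`a` and `c`. -/
theorem liftedGamma_sub_swap {B : V →ₗ[ℝ] V →ₗ[ℝ] ℝ} (hB : ∀ v w, B v w = B w v) (b : V)
    (a c : V × V) :
    liftedGamma B b a c - liftedGamma B b c a =
      (B b a.1 • c.1 - B b c.1 • a.1,
        (B b a.2 • c.1 - B b c.1 • a.2) + (B b a.1 • c.2 - B b c.2 • a.1)) := by
  simp only [liftedGamma_apply, hB c.1 a.1, hB c.2 a.2, hB c.1 a.2, hB a.1 c.2]
  refine Prod.ext ?_ ?_ <;> simp <;> module

/-- The operators `liftedGamma B b v` are skew for the product inner product on `V × V`. -/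
theorem liftedGamma_metric {B : V →ₗ[ℝ] V →ₗ[ℝ] ℝ} (hB : ∀ v w, B v w = B w v) (b : V)
    (v a c : V × V) :
    (B (liftedGamma B b v a).1 c.1 + B (liftedGamma B b v a).2 c.2) +
      (B a.1 (liftedGamma B b v c).1 + B a.2 (liftedGamma B b v c).2) = 0 := by
  simp only [liftedGamma_apply, map_add, map_sub, map_neg, map_smul, LinearMap.add_apply,
    LinearMap.sub_apply, LinearMap.neg_apply, LinearMap.smul_apply, smul_eq_mul]
  rw [hB c.1 v.2, hB a.1 b, hB a.1 v.1, hB a.2 v.2, hB a.1 v.2, hB a.2 b, hB a.2 v.1]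
  ring

/-- Koszul's uniqueness: a metric product is determined by its antisymmetrization. The difference
`T` of two such products is symmetric, and `m (T v a) c` is skew in `a` and `c`, so it vanishes. -/
theorem eq_of_metric_of_sub_swap {B : V →ₗ[ℝ] V →ₗ[ℝ] ℝ} (hB : ∀ v w, B v w = B w v)
    (hpos : ∀ v, v ≠ 0 → 0 < B v v) {D D' : V × V → V × V → V × V}
    (htor : ∀ a c, D a c - D c a = D' a c - D' c a)
    (hm : ∀ v a c, (B (D v a).1 c.1 + B (D v a).2 c.2) + (B a.1 (D v c).1 + B a.2 (D v c).2) = 0)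
    (hm' : ∀ v a c,
      (B (D' v a).1 c.1 + B (D' v a).2 c.2) + (B a.1 (D' v c).1 + B a.2 (D' v c).2) = 0)
    (a c : V × V) : D a c = D' a c := by
  let T : V × V → V × V → V × V := fun a c => D a c - D' a c
  have hs : ∀ a c, T a c = T c a := fun a c => by
    have := htor a c
    rw [sub_eq_sub_iff_add_eq_add] at this
    simp only [T]
    rw [sub_eq_sub_iff_add_eq_add, this, add_comm]
  let m : V × V → V × V → ℝ := fun a c => B a.1 c.1 + B a.2 c.2
  have hmm : ∀ a c, m a c = m c a := fun a c => by simp only [m, hB a.1, hB a.2]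
  have hskew : ∀ v a c, m (T v a) c = - m (T v c) a := fun v a c => by
    rw [hmm (T v c) a]
    simp only [m, T, Prod.fst_sub, Prod.snd_sub, map_sub, LinearMap.sub_apply]
    linarith [hm v a c, hm' v a c]
  have h0 : ∀ d, m (T a c) d = 0 := fun d => by
    have h1 := hskew a c d
    have h2 := hskew d a c
    have h3 := hskew c d a
    rw [hs a d] at h1
    rw [hs d c] at h2
    rw [hs c a] at h3
    linarith
  have h1 := h0 (T a c)
  have hnn : ∀ v, 0 ≤ B v v := fun v => by
    rcases eq_or_ne v 0 with rfl | h
    · simp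
    · exact (hpos v h).le
  have hz : ∀ v, B v v ≤ 0 → v = 0 := fun v hv => by
    by_contra h
    exact absurd (hpos v h) (not_lt.2 hv)
  have hT : T a c = 0 := Prod.ext (hz _ (by linarith [hnn (T a c).2]))
    (hz _ (by linarith [hnn (T a c).1]))
  exact sub_eq_zero.1 hT

/-- The endomorphism `w ↦ R(w, x)y` of the Lie algebra with connection `Γ`. -/
def gammaCurvature {k : Type*} [AddCommGroup k] [Module ℝ k] (Γ : k →ₗ[ℝ] k →ₗ[ℝ] k) (x y : k) :
    k →ₗ[ℝ] k :=
  Γ.flip (Γ x y) - Γ x ∘ₗ Γ.flip y - Γ.flip y ∘ₗ (Γ.flip x - Γ x)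

theorem gammaCurvature_apply {k : Type*} [AddCommGroup k] [Module ℝ k]
    (Γ : k →ₗ[ℝ] k →ₗ[ℝ] k) (x y w : k) :
    gammaCurvature Γ x y w = Γ w (Γ x y) - Γ x (Γ w y) - Γ (Γ w x - Γ x w) y := rfl

/-- The trace on `V × V` in the basis formed by two copies of the orthonormal basis `e`. -/
theorem trace_prod_eq_sum {ι : Type*} [Fintype ι] [DecidableEq ι]
    (e : Module.Basis ι ℝ V) {B : V →ₗ[ℝ] V →ₗ[ℝ] ℝ}
    (he : ∀ i j, B (e i) (e j) = if i = j then 1 else 0) (R : V × V →ₗ[ℝ] V × V) :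
    LinearMap.trace ℝ (V × V) R =
      ∑ i, B (R (e i, 0)).1 (e i) + ∑ i, B (R (0, e i)).2 (e i) := by
  have hr : ∀ v i, e.repr v i = B v (e i) := fun v i => by
    calc e.repr v i = B (∑ j, e.repr v j • e j) (e i) := by
          simp [map_sum, LinearMap.sum_apply, he, -Module.Basis.sum_repr]
      _ = B v (e i) := by rw [e.sum_repr]
  rw [LinearMap.trace_eq_matrix_trace ℝ (e.prod e), Matrix.trace, Fintype.sum_sum_type]
  simp [LinearMap.toMatrix_apply, hr]

/-- The Ricci tensor on lifts, as traces in the basis of the Lie algebra of `TG` formed by the lifts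
of the orthonormal basis `e`, the last vector of which is `b`. -/
theorem trace_gammaCurvature_liftedGamma {n : ℕ} (e : Module.Basis (Fin n ⊕ Unit) ℝ V)
    {B : V →ₗ[ℝ] V →ₗ[ℝ] ℝ} (hB : ∀ v w, B v w = B w v)
    (he : ∀ i j, B (e i) (e j) = if i = j then 1 else 0) {b : V} (hb : e (Sum.inr ()) = b)
    {x y : V} (hx : B b x = 0) (hy : B b y = 0) :
    let R := gammaCurvature (liftedGamma B b)
    LinearMap.trace ℝ (V × V) (R (x, 0) (y, 0)) = -(7 / 4 + 2 * n) * B x y +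
      5 / 4 * ∑ i, B x (e (Sum.inl i)) * B (e (Sum.inl i)) y ∧
    LinearMap.trace ℝ (V × V) (R (0, x) (0, y)) = -(3 / 4 + 2 * n) * B x y +
      5 / 4 * ∑ i, B x (e (Sum.inl i)) * B (e (Sum.inl i)) y ∧
    LinearMap.trace ℝ (V × V) (R (x, 0) (b, 0)) = 0 ∧
    LinearMap.trace ℝ (V × V) (R (x, 0) (0, b)) = 0 ∧
    LinearMap.trace ℝ (V × V) (R (0, x) (0, b)) = 0 ∧
    LinearMap.trace ℝ (V × V) (R (0, x) (b, 0)) = 0 ∧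
    LinearMap.trace ℝ (V × V) (R (x, 0) (0, y)) = 0 := by
  have hbb : B b b = 1 := by rw [← hb, he]; simp
  have hxb : B x b = 0 := by rw [hB, hx]
  have hyb : B y b = 0 := by rw [hB, hy]
  have hbu : ∀ i, B b (e (Sum.inl i)) = 0 := fun i => by rw [← hb, he]; simp
  have hub : ∀ i, B (e (Sum.inl i)) b = 0 := fun i => by rw [hB, hbu]
  have huu : ∀ i, B (e (Sum.inl i)) (e (Sum.inl i)) = 1 := fun i => by rw [he]; simp
  have hux : ∀ v i, B (e (Sum.inl i)) v = B v (e (Sum.inl i)) := fun v i => hB _ _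
  refine ⟨?_, ?_, ?_, ?_, ?_, ?_, ?_⟩ <;>
  · rw [trace_prod_eq_sum e he, Fintype.sum_sum_type, Fintype.sum_sum_type]
    simp only [gammaCurvature_apply, liftedGamma_apply, hb, Fintype.sum_unique,
      map_add, map_sub, map_neg, map_smul, map_zero, Prod.fst_sub, Prod.snd_sub,
      LinearMap.add_apply, LinearMap.zero_apply,
      LinearMap.sub_apply, LinearMap.neg_apply, LinearMap.smul_apply, smul_eq_mul,
      hbb, hxb, hyb, hx, hy, hbu, hub, huu, hux x, hux y, hB y x, mul_zero, mul_one,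
      add_zero, zero_add, sub_zero, zero_sub, neg_zero, smul_zero, zero_smul]
    ring_nf
    simp only [Finset.sum_add_distrib, ← Finset.sum_mul, Finset.sum_neg_distrib, Finset.sum_const,
      Finset.card_univ, Fintype.card_fin, nsmul_eq_mul, mul_zero, zero_mul,
      mul_comm (B y (e (Sum.inl _)))]
    try ring

end LiftedConnection

/-! ### Lifts of left invariant fields -/

section LieGroupLifts

open VectorField Topology

variable {E : Type*} [NormedAddCommGroup E] [NormedSpace ℝ E] {G : Type*} [TopologicalSpace G]
  [ChartedSpace E G] [Group G] [LieGroup 𝓘(ℝ, E) ∞ G]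

theorem lieGroup_minSmoothness_three : LieGroup 𝓘(ℝ, E) (minSmoothness ℝ 3) G := by
  simp only [minSmoothness_of_isRCLikeNormedField]
  exact LieGroup.of_le (n := ∞) ENat.LEInfty.out

theorem contMDiff_two_mulInvariantVectorField (x : GroupLieAlgebra 𝓘(ℝ, E) G) :
    ContMDiff 𝓘(ℝ, E) 𝓘(ℝ, E).tangent 2
      (fun q => (⟨q, mulInvariantVectorField x q⟩ : TangentBundle 𝓘(ℝ, E) G)) := by
  have := lieGroup_minSmoothness_three (E := E) (G := G)
  have h := contMDiff_mulInvariantVectorField (I := 𝓘(ℝ, E)) x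
  simpa only [minSmoothness_of_isRCLikeNormedField] using h

/-- The field `x^c + y^v` on `TG`, linear in the pair `(x, y)`. -/
def lieLift : GroupLieAlgebra 𝓘(ℝ, E) G × GroupLieAlgebra 𝓘(ℝ, E) G →ₗ[ℝ]
    ∀ p : TangentBundle 𝓘(ℝ, E) G, TangentSpace 𝓘(ℝ, E).tangent p where
  toFun z p := lieC z.1 p + lieV z.2 p
  map_add' z w := by
    have : IsManifold 𝓘(ℝ, E) 2 G := IsManifold.of_le (n := ∞) ENat.LEInfty.out
    have h := fun x : GroupLieAlgebra 𝓘(ℝ, E) G =>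
      (contMDiff_two_mulInvariantVectorField x).of_le (m := 1) (by norm_num)
    ext1 p
    have hc : lieC (z + w).1 p = lieC z.1 p + lieC w.1 p := by
      simp only [lieC, Prod.fst_add, mulInvariantVectorField_add]
      exact completeLift_add (h _) (h _) p
    have hv : lieV (z + w).2 p = lieV z.2 p + lieV w.2 p := by
      simp only [lieV, Prod.snd_add, mulInvariantVectorField_add, verticalLift_eq]
      exact Prod.ext (add_zero (0 : E)).symm rfl
    change lieC (z + w).1 p + lieV (z + w).2 p =
      (lieC z.1 p + lieV z.2 p) + (lieC w.1 p + lieV w.2 p)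
    rw [hc, hv, add_add_add_comm]
  map_smul' r z := by
    have : IsManifold 𝓘(ℝ, E) 2 G := IsManifold.of_le (n := ∞) ENat.LEInfty.out
    have h := fun x : GroupLieAlgebra 𝓘(ℝ, E) G =>
      (contMDiff_two_mulInvariantVectorField x).of_le (m := 1) (by norm_num)
    ext1 p
    have hc : lieC (r • z).1 p = r • lieC z.1 p := by
      simp only [lieC, Prod.smul_fst, mulInvariantVectorField_smul]
      exact completeLift_const_smul (h _) r p
    have hv : lieV (r • z).2 p = r • lieV z.2 p := by
      simp only [lieV, Prod.smul_snd, mulInvariantVectorField_smul, verticalLift_eq]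
      exact Prod.ext (smul_zero r).symm rfl
    change lieC (r • z).1 p + lieV (r • z).2 p = r • (lieC z.1 p + lieV z.2 p)
    rw [hc, hv, smul_add]

theorem lieLift_apply (z : GroupLieAlgebra 𝓘(ℝ, E) G × GroupLieAlgebra 𝓘(ℝ, E) G)
    (p : TangentBundle 𝓘(ℝ, E) G) : lieLift z p = lieC z.1 p + lieV z.2 p := rfl

theorem lieLift_left (x : GroupLieAlgebra 𝓘(ℝ, E) G) :
    lieLift (x, 0) = (lieC x : ∀ _ : TangentBundle 𝓘(ℝ, E) G, _) := by
  have : IsManifold 𝓘(ℝ, E) 2 G := IsManifold.of_le (n := ∞) ENat.LEInfty.out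
  ext1 p
  have h : lieV (0 : GroupLieAlgebra 𝓘(ℝ, E) G) p = 0 := by
    rw [lieV, verticalLift_eq]
    exact Prod.ext rfl (map_zero (mfderiv 𝓘(ℝ, E) 𝓘(ℝ, E) (fun z => p.1 * z) (1 : G)))
  exact (congrArg (lieC x p + ·) h).trans (add_zero _)

theorem lieLift_right (x : GroupLieAlgebra 𝓘(ℝ, E) G) :
    lieLift (0, x) = (lieV x : ∀ _ : TangentBundle 𝓘(ℝ, E) G, _) := by
  ext1 p
  have h : lieC (0 : GroupLieAlgebra 𝓘(ℝ, E) G) p = 0 := by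
    have h1 := completeLift_const_smul
      ((contMDiff_two_mulInvariantVectorField x).of_le (m := 1) (by norm_num)) 0 p
    rwa [← mulInvariantVectorField_smul, zero_smul, zero_smul] at h1
  exact (congrArg (· + lieV x p) h).trans (zero_add _)

theorem bijective_lieLift [FiniteDimensional ℝ E] (p : TangentBundle 𝓘(ℝ, E) G) :
    Function.Bijective fun z => lieLift z p := by
  have hinj : Function.Injective fun z => lieLift z p :=
    Function.LeftInverse.injective (g := liftComponents p) fun z => liftComponents_lift p z.1 z.2
  have : FiniteDimensional ℝ (GroupLieAlgebra 𝓘(ℝ, E) G) := inferInstanceAs (FiniteDimensional ℝ E)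
  have : FiniteDimensional ℝ (TangentSpace 𝓘(ℝ, E).tangent p) :=
    inferInstanceAs (FiniteDimensional ℝ (E × E))
  refine ⟨hinj, ?_⟩
  exact (LinearMap.injective_iff_surjective_of_finrank_eq_finrank
    (f := (LinearMap.proj p ∘ₗ lieLift)) rfl).1 hinj

theorem fieldDifferentiableAt_lieLift
    (z : GroupLieAlgebra 𝓘(ℝ, E) G × GroupLieAlgebra 𝓘(ℝ, E) G)
    (p : TangentBundle 𝓘(ℝ, E) G) :
    FieldDifferentiableAt (I := 𝓘(ℝ, E).tangent) (lieLift z) p :=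
  fieldDifferentiableAt_liftSum (contMDiff_two_mulInvariantVectorField z.1)
    ((contMDiff_two_mulInvariantVectorField z.2).of_le (by norm_num)) p

/-- The Lie algebra of lifts: `[x^c, y^c] = [x, y]^c`, `[x^c, y^v] = [x, y]^v`,
`[x^v, y^v] = 0`. -/
theorem mlieBracket_lieLift [FiniteDimensional ℝ E]
    (a c : GroupLieAlgebra 𝓘(ℝ, E) G × GroupLieAlgebra 𝓘(ℝ, E) G)
    (p : TangentBundle 𝓘(ℝ, E) G) :
    mlieBracket 𝓘(ℝ, E).tangent (lieLift a) (lieLift c) p =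
      lieLift (⁅a.1, c.1⁆, ⁅a.2, c.1⁆ + ⁅a.1, c.2⁆) p := by
  have := lieGroup_minSmoothness_three (E := E) (G := G)
  have : CompleteSpace E := FiniteDimensional.complete ℝ E
  have h := mlieBracket_liftSum (contMDiff_two_mulInvariantVectorField a.1)
    ((contMDiff_two_mulInvariantVectorField a.2).of_le (by norm_num))
    (contMDiff_two_mulInvariantVectorField c.1)
    ((contMDiff_two_mulInvariantVectorField c.2).of_le (by norm_num)) p
  simp only [← mulInvariantVector_mlieBracket, ← GroupLieAlgebra.bracket_def,
    ← mulInvariantVectorField_add] at h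
  exact h

/-- In the presence of an adapted pair `(U, b)` with `g(b, b) = 1` the bracket of the Lie algebra is
`[x, y] = g(b, x) y - g(b, y) x`. -/
theorem IsAdaptedPair.bracket_eq [FiniteDimensional ℝ E]
    {g : Bundle.ContMDiffRiemannianMetric 𝓘(ℝ, E) ∞ E (TangentSpace 𝓘(ℝ, E) : G → Type _)}
    {U : Submodule ℝ (GroupLieAlgebra 𝓘(ℝ, E) G)} {b : GroupLieAlgebra 𝓘(ℝ, E) G}
    (h : IsAdaptedPair g U b) (hb : g.inner 1 b b = 1) (x y : GroupLieAlgebra 𝓘(ℝ, E) G) :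
    ⁅x, y⁆ = g.inner 1 b x • y - g.inner 1 b y • x := by
  have := lieGroup_minSmoothness_three (E := E) (G := G)
  have : CompleteSpace E := FiniteDimensional.complete ℝ E
  have : FiniteDimensional ℝ (GroupLieAlgebra 𝓘(ℝ, E) G) := inferInstanceAs (FiniteDimensional ℝ E)
  have hbU : b ∉ U := fun hbU => by
    have := h.orthogonal b hbU
    rw [hb] at this
    exact one_ne_zero this
  have hb0 : U.mkQ b ≠ 0 := fun h0 => hbU ((Submodule.Quotient.mk_eq_zero U).1 h0)
  -- as `U` has codimension one, `b` spans a complement of it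
  have hdec : ∀ z, ∃ v ∈ U, ∃ s : ℝ, z = v + s • b := fun z => by
    obtain ⟨s, hs⟩ := exists_smul_eq_of_finrank_eq_one h.codim_one hb0 (U.mkQ z)
    refine ⟨z - s • b, ?_, s, by abel⟩
    rw [← Submodule.Quotient.mk_eq_zero, ← Submodule.mkQ_apply, map_sub, map_smul, hs, sub_self]
  have hval : ∀ v ∈ U, ∀ s : ℝ, g.inner 1 b (v + s • b) = s := fun v hv s => by
    rw [map_add, map_smul, h.orthogonal v hv, hb, zero_add, smul_eq_mul, mul_one]
  obtain ⟨v, hv, s, rfl⟩ := hdec x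
  obtain ⟨w, hw, t, rfl⟩ := hdec y
  have hvb : ⁅v, b⁆ = -v := by rw [← lie_skew, h.bracket v hv]
  rw [hval v hv, hval w hw]
  simp only [add_lie, lie_add, smul_lie, lie_smul, h.commutative v hv w hw, hvb, h.bracket w hw,
    lie_self]
  module

/-- The inner product of the Lie algebra given by the metric `g`, as a bilinear map. -/
def lieInner (g : Bundle.ContMDiffRiemannianMetric 𝓘(ℝ, E) ∞ E
      (TangentSpace 𝓘(ℝ, E) : G → Type _)) :
    GroupLieAlgebra 𝓘(ℝ, E) G →ₗ[ℝ] GroupLieAlgebra 𝓘(ℝ, E) G →ₗ[ℝ] ℝ :=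
  LinearMap.mk₂ ℝ (fun v w => g.inner 1 v w) (by simp) (by simp) (by simp) (by simp)

theorem lieInner_apply (g : Bundle.ContMDiffRiemannianMetric 𝓘(ℝ, E) ∞ E
      (TangentSpace 𝓘(ℝ, E) : G → Type _)) (v w : GroupLieAlgebra 𝓘(ℝ, E) G) :
    lieInner g v w = g.inner 1 v w := rfl

/-- The Levi-Civita connection of the lifted metric has constant coefficients `liftedGamma` in the
frame of lifts of left invariant fields. -/
theorem IsLeviCivita.apply_lieLift [FiniteDimensional ℝ E]
    {g : Bundle.ContMDiffRiemannianMetric 𝓘(ℝ, E) ∞ E (TangentSpace 𝓘(ℝ, E) : G → Type _)}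
    {b : GroupLieAlgebra 𝓘(ℝ, E) G}
    (hbr : ∀ x y : GroupLieAlgebra 𝓘(ℝ, E) G, ⁅x, y⁆ = g.inner 1 b x • y - g.inner 1 b y • x)
    {nabla : CovariantDerivative 𝓘(ℝ, E).tangent (E × E)
      (TangentSpace 𝓘(ℝ, E).tangent : TangentBundle 𝓘(ℝ, E) G → Type _)}
    (hnabla : IsLeviCivita (liftedMetric g) nabla)
    (a c : GroupLieAlgebra 𝓘(ℝ, E) G × GroupLieAlgebra 𝓘(ℝ, E) G)
    (p : TangentBundle 𝓘(ℝ, E) G) :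
    nabla (lieLift c) p (lieLift a p) = lieLift (liftedGamma (lieInner g) b a c) p := by
  let A : (GroupLieAlgebra 𝓘(ℝ, E) G × GroupLieAlgebra 𝓘(ℝ, E) G) ≃ₗ[ℝ]
      TangentSpace 𝓘(ℝ, E).tangent p :=
    LinearEquiv.ofBijective (LinearMap.proj p ∘ₗ lieLift) (bijective_lieLift p)
  have hA : ∀ z, A z = lieLift z p := fun z => rfl
  let D : GroupLieAlgebra 𝓘(ℝ, E) G × GroupLieAlgebra 𝓘(ℝ, E) G →
      GroupLieAlgebra 𝓘(ℝ, E) G × GroupLieAlgebra 𝓘(ℝ, E) G →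
      GroupLieAlgebra 𝓘(ℝ, E) G × GroupLieAlgebra 𝓘(ℝ, E) G :=
    fun a c => A.symm (nabla (lieLift c) p (lieLift a p))
  have hD : ∀ a c, lieLift (D a c) p = nabla (lieLift c) p (lieLift a p) :=
    fun a c => A.apply_symm_apply _
  have hB : ∀ v w, lieInner g v w = lieInner g w v := fun v w => g.symm 1 v w
  have key : D a c = liftedGamma (lieInner g) b a c := by
    refine eq_of_metric_of_sub_swap hB (fun v hv => g.pos 1 v hv) (D := D) (D' := fun a c =>
      liftedGamma (lieInner g) b a c) (fun a c => ?_) (fun v a c => ?_)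
      (liftedGamma_metric hB b) a c
    · refine A.injective ?_
      rw [liftedGamma_sub_swap hB, map_sub, hA, hA, hD, hD,
        nabla.torsion_eq_zero_iff.1 hnabla.torsion_free (fieldDifferentiableAt_lieLift a p)
          (fieldDifferentiableAt_lieLift c p), mlieBracket_lieLift, hA]
      simp only [hbr, lieInner_apply]
    · have h := hnabla.metric p (lieLift v p) (lieLift a) (lieLift c)
        (fieldDifferentiableAt_lieLift a p) (fieldDifferentiableAt_lieLift c p)
      have hconst : (fun q => liftedMetric g q (lieLift a q) (lieLift c q)) =
          fun _ => g.inner 1 a.1 c.1 + g.inner 1 a.2 c.2 :=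
        funext fun q => liftedMetric_lift g q _ _ _ _
      rw [hconst, mvfderiv_const, ← hD, ← hD] at h
      have h1 := liftedMetric_lift g p (D v a).1 (D v a).2 c.1 c.2
      have h2 := liftedMetric_lift g p a.1 a.2 (D v c).1 (D v c).2
      simp only [lieLift_apply] at h
      rw [h1, h2] at h
      exact h.symm
  rw [← key, hD]

end LieGroupLifts

end

/-! ### The Ricci tensor -/

theorem mainTheorem3 {E : Type*} [NormedAddCommGroup E] [NormedSpace ℝ E]
    [FiniteDimensional ℝ E] {G : Type*} [TopologicalSpace G] [ChartedSpace E G] [Group G]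
    [LieGroup 𝓘(ℝ, E) ∞ G]
    (n : ℕ) (hdim : Module.finrank ℝ E = n + 1)
    (hG : IsSpecialLieGroup 𝓘(ℝ, E) G)
    (g : Bundle.ContMDiffRiemannianMetric 𝓘(ℝ, E) ∞ E (TangentSpace 𝓘(ℝ, E) : G → Type _))
    (hg : IsLeftInvariant g)
    (U : Submodule ℝ (GroupLieAlgebra 𝓘(ℝ, E) G)) (b : GroupLieAlgebra 𝓘(ℝ, E) G)
    (hUb : IsAdaptedPair g U b)
    (u : Fin n → GroupLieAlgebra 𝓘(ℝ, E) G)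
    (hu : IsOrthonormalBasis g (Sum.elim u (fun _ : Unit => b)))
    (lam : ℝ) (hlam : lam = g.inner 1 b b)
    (nabla : CovariantDerivative 𝓘(ℝ, E).tangent (E × E)
      (TangentSpace 𝓘(ℝ, E).tangent : TangentBundle 𝓘(ℝ, E) G → Type _))
    (hnabla : IsLeviCivita (liftedMetric g) nabla)
    (x y : GroupLieAlgebra 𝓘(ℝ, E) G) (hx : x ∈ U) (hy : y ∈ U)
    (p : TangentBundle 𝓘(ℝ, E) G) :
    ricci nabla (lieC x) (lieC y) p =
        -(7 / 4 + 2 * n / lam) * g.inner 1 x y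
          + 5 / (4 * lam) * ∑ i, g.inner 1 x (u i) * g.inner 1 (u i) y ∧
      ricci nabla (lieV x) (lieV y) p =
        -(3 / 4 + 2 * n / lam) * g.inner 1 x y
          + 5 / (4 * lam) * ∑ i, g.inner 1 x (u i) * g.inner 1 (u i) y ∧
      ricci nabla (lieC x) (lieC b) p = 0 ∧
      ricci nabla (lieC x) (lieV b) p = 0 ∧
      ricci nabla (lieV x) (lieV b) p = 0 ∧
      ricci nabla (lieV x) (lieC b) p = 0 ∧
      ricci nabla (lieC x) (lieV y) p = 0 := by
  have hbb : g.inner 1 b b = 1 := by simpa using hu.1 (Sum.inr ()) (Sum.inr ())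
  have : FiniteDimensional ℝ (GroupLieAlgebra 𝓘(ℝ, E) G) := inferInstanceAs (FiniteDimensional ℝ E)
  have hcard : Fintype.card (Fin n ⊕ Unit) = Module.finrank ℝ (GroupLieAlgebra 𝓘(ℝ, E) G) := by
    simpa using! hdim.symm
  let e : Module.Basis (Fin n ⊕ Unit) ℝ (GroupLieAlgebra 𝓘(ℝ, E) G) :=
    basisOfTopLeSpanOfCardEqFinrank (Sum.elim u (fun _ : Unit => b)) hu.2.ge hcard
  have he : ∀ i, e i = Sum.elim u (fun _ : Unit => b) i := fun i => by
    simp only [e, coe_basisOfTopLeSpanOfCardEqFinrank]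
  have hric : ∀ a c : GroupLieAlgebra 𝓘(ℝ, E) G × GroupLieAlgebra 𝓘(ℝ, E) G,
      ricci nabla (lieLift a) (lieLift c) p =
        LinearMap.trace ℝ _ (gammaCurvature (liftedGamma (lieInner g) b) a c) := fun a c =>
    ricci_eq_trace lieLift fieldDifferentiableAt_lieLift nabla hnabla.torsion_free _
      (hnabla.apply_lieLift (hUb.bracket_eq hbb)) (bijective_lieLift p) a c _
      (gammaCurvature_apply _ a c)
  have key := trace_gammaCurvature_liftedGamma e (B := lieInner g) (b := b)
    (fun v w => g.symm 1 v w) (fun i j => by rw [he, he]; exact hu.1 i j) (he _)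
    (hUb.orthogonal x hx) (hUb.orthogonal y hy)
  simp only [← hric, lieLift_left, lieLift_right, he, Sum.elim_inl, lieInner_apply] at key
  rw [hlam, hbb]
  simpa only [div_one, mul_one] using key
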